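/- **Conventions.** A super $L_\infty$-algebra (of finite type, over $\mathbb R$) is a graded super vector space $\mathfrak g=\bigoplus_{k\ge 0}\mathfrak g_k$ (homological degree $k$, cohomological degree $-k$), degreewise finite-dimensional, together with the structure encoded by its Chevalley–Eilenberg algebra $\mathrm{CE}(\mathfrak g)$: the free $(\mathbb Z\times\mathbb Z_2)$-graded commutative superalgebra on $\mathfrak g[1]^*$, where $\mathfrak g_k^*$ sits in degree $k+1$, with a differential $d$ of bidegree $(1,\mathrm{even})$. A homomorphism $\mathfrak g\to\mathfrak h$ is a homomorphism of dg-superalgebras $\mathrm{CE}(\mathfrak h)\to\mathrm{CE}(\mathfrak g)$. It is a weak equivalence if its linear component $\mathfrak g\to\mathfrak h$ is a quasi-isomorphism of the chain complexes given by the unary brackets, and a fibration if its linear component is degreewise surjective. Two $L_\infty$-algebras over $\mathfrak g$ are equivalent over $\mathfrak g$ if they are connected by a zigzag of weak equivalences over $\mathfrak g$. $\mathbb R[n]$ is the $L_\infty$-algebra whose Chevalley–Eilenberg algebra is free on one closed even generator of degree $n+1$. A homotopy fiber of $f:\mathfrak g\to\mathfrak h$ is a homomorphism $\mathfrak k\to\mathfrak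 g$ that is equivalent over $\mathfrak g$ to a strict pullback along $f$ of some fibration $\mathfrak e\to\mathfrak h$, where $0\to\mathfrak h$ factors as a weak equivalence $0\to\mathfrak e$ followed by this fibration. **Proposition 3.5.** Let $\mathfrak g$ be a super $L_\infty$-algebra of finite type, let $n\ge 1$, and let $\mu\in\mathrm{CE}(\mathfrak g)$ be a cocycle of degree $n+1$, that is, a closed even element of degree $n+1$; equivalently, a homomorphism $\mu:\mathfrak g\to\mathbb R[n]$. Let $\mathrm{CE}(\mathfrak g)[c_n]$ be the graded commutative superalgebra obtained from $\mathrm{CE}(\mathfrak g)$ by freely adjoining one even generator $c_n$ of degree $n$. 1. There is exactly one differential on $\mathrm{CE}(\mathfrak g)[c_n]$ that restricts to the given differential on $\mathrm{CE}(\mathfrak g)$ and satisfies $d c_n=\mu$. With it, $\mathrm{CE}(\mathfrak g)[c_n]$ is the Chevalley–Eilenberg algebra of a super $L_\infty$-algebra $\mathfrak g_\mu$ with underlying space $\mathfrak g\oplus\mathbb R[n-1]$. 2. The homomorphism $\mathfrak g_\mu\to\mathfrak g$ dual to the inclusion $\mathrm{CE}(\mathfrak g)\hookrightarrow\mathrm{CE}(\mathfrak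 g)[c_n]$ is a homotopy fiber of $\mu:\mathfrak g\to\mathbb R[n]$. 3. Every homotopy fiber $\widehat{\mathfrak g}\to\mathfrak g$ of $\mu$ is equivalent over $\mathfrak g$ to $\mathfrak g_\mu\to\mathfrak g$. -/

import Mathlib

open CategoryTheory

noncomputable section

/-! ### Graded super vector spaces of finite type -/

/-- A degreewise finite-dimensional graded real super vector space `V`, concentrated in
non-negative homological degrees: `V.carrier k s` is the component of homological degree `k`
(cohomological degree `-k`) and parity `s`. -/
structure GradedSuperSpace where
  carrier : ℕ → ZMod 2 → Type
  [addCommGroup : ∀ k s, AddCommGroup (carrier k s)]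
  [module : ∀ k s, Module ℝ (carrier k s)]
  [finiteDimensional : ∀ k s, FiniteDimensional ℝ (carrier k s)]

attribute [instance] GradedSuperSpace.addCommGroup GradedSuperSpace.module
  GradedSuperSpace.finiteDimensional

namespace GradedSuperSpace

/-- The zero space. -/
def zero : GradedSuperSpace where
  carrier _ _ := PUnit

/-- The real line, in homological degree `n` and even parity; zero in all other degrees. -/
def line (n : ℕ) : GradedSuperSpace where
  carrier k s := ↥(if k = n ∧ s = 0 then ⊤ else ⊥ : Submodule ℝ ℝ)

/-- The direct sum of two graded super vector spaces. -/
def sum (V W : GradedSuperSpace) : GradedSuperSpace where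
  carrier k s := V.carrier k s × W.carrier k s

/-- The underlying vector space of `V[1]^*`: the direct sum of the duals of all the components. The
summand `(k, s)`, the dual of the component of homological degree `k` and parity `s`, sits in
cohomological degree `k + 1` and parity `s`. -/
abbrev ShiftedDual (V : GradedSuperSpace) : Type :=
  DirectSum (ℕ × ZMod 2) fun i => Module.Dual ℝ (V.carrier i.1 i.2)

/-- The Koszul sign `(-1)^(k l + s t)` of elements of bidegrees `(k, s)`, `(l, t)`. -/
def koszulSign (i j : ℕ × ZMod 2) : ℝ := (-1) ^ (i.1 * j.1 + i.2.val * j.2.val)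

/-- The bidegree, in `V[1]^*`, of the dual of the component `i` of `V`. -/
def shift (i : ℕ × ZMod 2) : ℕ × ZMod 2 := (i.1 + 1, i.2)

/-- The inclusion of the dual of the component `i` into `V[1]^*`. -/
abbrev inDual (V : GradedSuperSpace) (i : ℕ × ZMod 2) :
    Module.Dual ℝ (V.carrier i.1 i.2) →ₗ[ℝ] V.ShiftedDual :=
  DirectSum.lof ℝ (ℕ × ZMod 2) (fun i => Module.Dual ℝ (V.carrier i.1 i.2)) i

/-- The relations of graded commutativity between generators. -/
inductive SymRel (V : GradedSuperSpace) :
    TensorAlgebra ℝ V.ShiftedDual → TensorAlgebra ℝ V.ShiftedDual → Prop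
  | comm (i j : ℕ × ZMod 2) (α : Module.Dual ℝ (V.carrier i.1 i.2))
      (β : Module.Dual ℝ (V.carrier j.1 j.2)) :
      SymRel V
        (TensorAlgebra.ι ℝ (V.inDual i α) * TensorAlgebra.ι ℝ (V.inDual j β))
        (koszulSign (shift i) (shift j) •
          (TensorAlgebra.ι ℝ (V.inDual j β) * TensorAlgebra.ι ℝ (V.inDual i α)))

/-- The free graded commutative superalgebra on `V[1]^*`. -/
abbrev Sym (V : GradedSuperSpace) : Type := RingQuot (SymRel V)

/-- The inclusion of the space of generators. -/
def gens (V : GradedSuperSpace) : V.ShiftedDual →ₗ[ℝ] V.Sym :=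
  (RingQuot.mkAlgHom ℝ (SymRel V)).toLinearMap ∘ₗ TensorAlgebra.ι ℝ

/-- The generator given by a linear form on the component `i`, of bidegree `shift i`. -/
def gen (V : GradedSuperSpace) (i : ℕ × ZMod 2) (α : Module.Dual ℝ (V.carrier i.1 i.2)) : V.Sym :=
  V.gens (V.inDual i α)

/-- The product of a list of homogeneous generators. -/
def monomial (V : GradedSuperSpace)
    (l : List (Σ i : ℕ × ZMod 2, Module.Dual ℝ (V.carrier i.1 i.2))) : V.Sym :=
  (l.map fun x => V.gen x.1 x.2).prod

/-- The bidegree of a product of homogeneous generators. -/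
def monomialDegree (V : GradedSuperSpace)
    (l : List (Σ i : ℕ × ZMod 2, Module.Dual ℝ (V.carrier i.1 i.2))) : ℕ × ZMod 2 :=
  (l.map fun x => shift x.1).sum

/-- The component of bidegree `i` of the free graded commutative superalgebra. -/
def homog (V : GradedSuperSpace) (i : ℕ × ZMod 2) : Submodule ℝ V.Sym :=
  Submodule.span ℝ {a | ∃ l, V.monomialDegree l = i ∧ V.monomial l = a}

theorem gen_comm (V : GradedSuperSpace) (i j : ℕ × ZMod 2)
    (α : Module.Dual ℝ (V.carrier i.1 i.2)) (β : Module.Dual ℝ (V.carrier j.1 j.2)) :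
    V.gen i α * V.gen j β = koszulSign (shift i) (shift j) • (V.gen j β * V.gen i α) := by
  have h := RingQuot.mkAlgHom_rel ℝ (SymRel.comm (V := V) i j α β)
  simpa [gen, gens] using h

/-- The universal property: an algebra map out of the free graded commutative superalgebra is given
by a linear map on generators whose values commute up to the Koszul signs. -/
def lift (V : GradedSuperSpace) {A : Type} [Ring A] [Algebra ℝ A] (f : V.ShiftedDual →ₗ[ℝ] A)
    (hf : ∀ i j α β, f (V.inDual i α) * f (V.inDual j β) =
      koszulSign (shift i) (shift j) • (f (V.inDual j β) * f (V.inDual i α))) :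
    V.Sym →ₐ[ℝ] A :=
  RingQuot.liftAlgHom ℝ ⟨TensorAlgebra.lift ℝ f, by
    rintro _ _ ⟨i, j, α, β⟩
    simpa using hf i j α β⟩

theorem lift_gens (V : GradedSuperSpace) {A : Type} [Ring A] [Algebra ℝ A]
    (f : V.ShiftedDual →ₗ[ℝ] A) (hf) (v : V.ShiftedDual) : V.lift f hf (V.gens v) = f v := by
  simp [lift, gens]

/-- The projection of the free graded commutative superalgebra onto its generators, which kills
constants and all products of two or more generators: the value of the generator `v` under the algebra
map to the square-zero extension of `ℝ` by `V[1]^*` is `v`. -/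
def linearPart (V : GradedSuperSpace) : V.Sym →ₗ[ℝ] V.ShiftedDual :=
  TrivSqZeroExt.sndHom ℝ V.ShiftedDual ∘ₗ
    (V.lift (A := TrivSqZeroExt ℝ V.ShiftedDual) (TrivSqZeroExt.inrHom ℝ V.ShiftedDual)
      (by intro i j α β; simp)).toLinearMap

theorem linearPart_gens (V : GradedSuperSpace) (v : V.ShiftedDual) :
    V.linearPart (V.gens v) = v := by
  simp [linearPart, lift_gens]

theorem hom_ext (V : GradedSuperSpace) {A : Type} [Ring A] [Algebra ℝ A] {f g : V.Sym →ₐ[ℝ] A}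
    (h : ∀ v, f (V.gens v) = g (V.gens v)) : f = g := by
  apply RingQuot.ringQuot_ext'
  apply TensorAlgebra.hom_ext
  exact LinearMap.ext h

/-- A family of linear maps `V → W` in each degree induces `Sym W → Sym V` by transposition. -/
def symMap {V W : GradedSuperSpace} (f : ∀ k s, V.carrier k s →ₗ[ℝ] W.carrier k s) :
    W.Sym →ₐ[ℝ] V.Sym :=
  W.lift (DirectSum.toModule ℝ _ _ fun i =>
      V.gens ∘ₗ V.inDual i ∘ₗ Module.Dual.transpose (f i.1 i.2)) (by
    intro i j α β
    simp only [inDual, DirectSum.toModule_lof]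
    exact V.gen_comm i j _ _)

theorem symMap_gen {V W : GradedSuperSpace} (f : ∀ k s, V.carrier k s →ₗ[ℝ] W.carrier k s)
    (i : ℕ × ZMod 2) (α : Module.Dual ℝ (W.carrier i.1 i.2)) :
    symMap f (W.gen i α) = V.gen i (α ∘ₗ f i.1 i.2) := by
  simp only [symMap, gen, lift_gens, inDual, DirectSum.toModule_lof]
  rfl

theorem one_mem_homog (V : GradedSuperSpace) : (1 : V.Sym) ∈ V.homog 0 :=
  Submodule.subset_span ⟨[], rfl, rfl⟩

theorem gen_mem_homog (V : GradedSuperSpace) (i : ℕ × ZMod 2)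
    (α : Module.Dual ℝ (V.carrier i.1 i.2)) : V.gen i α ∈ V.homog (shift i) :=
  Submodule.subset_span ⟨[⟨i, α⟩], by simp [monomialDegree], by simp [monomial]⟩

theorem mul_mem_homog (V : GradedSuperSpace) {i j : ℕ × ZMod 2} {a b : V.Sym}
    (ha : a ∈ V.homog i) (hb : b ∈ V.homog j) : a * b ∈ V.homog (i + j) := by
  have h : V.homog i * V.homog j ≤ V.homog (i + j) := by
    rw [homog, homog, Submodule.span_mul_span, Submodule.span_le]
    rintro _ ⟨_, ⟨l, rfl, rfl⟩, _, ⟨m, rfl, rfl⟩, rfl⟩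
    exact Submodule.subset_span ⟨l ++ m, by simp [monomialDegree], by simp [monomial]⟩
  exact h (Submodule.mul_mem_mul ha hb)

theorem koszulSign_mul_self (i j : ℕ × ZMod 2) : koszulSign i j * koszulSign i j = 1 := by
  simp [koszulSign, ← mul_pow]

theorem koszulSign_zero (i : ℕ × ZMod 2) : koszulSign i 0 = 1 := by
  simp [koszulSign]

theorem koszulSign_comm (i j : ℕ × ZMod 2) : koszulSign i j = koszulSign j i := by
  simp [koszulSign, mul_comm]

theorem koszulSign_add (i j k : ℕ × ZMod 2) :
    koszulSign i (j + k) = koszulSign i j * koszulSign i k := by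
  obtain ⟨a, s⟩ := i
  obtain ⟨b, t⟩ := j
  obtain ⟨c, u⟩ := k
  simp only [koszulSign, Prod.mk_add_mk, ← pow_add]
  apply neg_one_pow_congr
  have key : ∀ s t u : ZMod 2, Even (s.val * (t + u).val + (s.val * t.val + s.val * u.val)) := by
    decide
  have h := key s t u
  have h2 : Even (2 * (a * b + a * c)) := even_two_mul _
  rw [Nat.even_iff] at *
  rw [Nat.even_iff]
  ring_nf at *
  omega

theorem mul_comm_of_mem_homog (V : GradedSuperSpace) {i j : ℕ × ZMod 2} {a b : V.Sym}
    (ha : a ∈ V.homog i) (hb : b ∈ V.homog j) : a * b = koszulSign i j • (b * a) := by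
  -- first against a generator, then against all monomials
  have h1 : ∀ (x : Σ i : ℕ × ZMod 2, Module.Dual ℝ (V.carrier i.1 i.2)) (m : List _),
      V.gen x.1 x.2 * V.monomial m =
        koszulSign (shift x.1) (V.monomialDegree m) • (V.monomial m * V.gen x.1 x.2) := by
    intro x m
    induction m with
    | nil => simp [monomial, monomialDegree, koszulSign_zero]
    | cons y m ih =>
      simp only [monomial, monomialDegree, List.map_cons, List.prod_cons, List.sum_cons] at ih ⊢
      rw [← mul_assoc, gen_comm, smul_mul_assoc, mul_assoc, ih, mul_smul_comm, smul_smul,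
        koszulSign_add, mul_assoc]
  have h2 : ∀ l m : List (Σ i : ℕ × ZMod 2, Module.Dual ℝ (V.carrier i.1 i.2)),
      V.monomial l * V.monomial m =
        koszulSign (V.monomialDegree l) (V.monomialDegree m) • (V.monomial m * V.monomial l) := by
    intro l m
    induction l with
    | nil => simp [monomial, monomialDegree, koszulSign_comm 0, koszulSign_zero]
    | cons y l ih =>
      have h := h1 y m
      simp only [monomial, monomialDegree, List.map_cons, List.prod_cons, List.sum_cons] at h ih ⊢
      rw [mul_assoc, ih, mul_smul_comm, ← mul_assoc, h, smul_mul_assoc, smul_smul,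
        koszulSign_comm (_ + _), koszulSign_add, koszulSign_comm (List.sum _) (shift _),
        koszulSign_comm (List.sum _) (List.sum _), mul_assoc, mul_comm (koszulSign (shift _) _)]
  induction ha using Submodule.span_induction with
  | zero => simp
  | add x y _ _ hx hy => rw [add_mul, hx, hy, mul_add, smul_add]
  | smul r x _ hx => rw [smul_mul_assoc, hx, mul_smul_comm, smul_comm]
  | mem x hx =>
    obtain ⟨l, rfl, rfl⟩ := hx
    induction hb using Submodule.span_induction with
    | zero => simp
    | add x y _ _ hx hy => rw [mul_add, add_mul, hx, hy, smul_add]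
    | smul r x _ hx => rw [smul_mul_assoc, mul_smul_comm, hx, smul_comm]
    | mem x hx =>
      obtain ⟨m, rfl, rfl⟩ := hx
      exact h2 l m

theorem span_monomials (V : GradedSuperSpace) :
    Submodule.span ℝ (Set.range V.monomial) = ⊤ := by
  have hgen : ∀ i α, V.gen i α ∈ Submodule.span ℝ (Set.range V.monomial) := fun i α =>
    Submodule.subset_span ⟨[⟨i, α⟩], by simp [monomial]⟩
  have hmul : ∀ a b, a ∈ Submodule.span ℝ (Set.range V.monomial) →
      b ∈ Submodule.span ℝ (Set.range V.monomial) →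
      a * b ∈ Submodule.span ℝ (Set.range V.monomial) := by
    intro a b ha hb
    have h := Submodule.mul_mem_mul ha hb
    rw [Submodule.span_mul_span] at h
    refine Submodule.span_mono ?_ h
    rintro _ ⟨_, ⟨l, rfl⟩, _, ⟨m, rfl⟩, rfl⟩
    exact ⟨l ++ m, by simp [monomial]⟩
  refine eq_top_iff.2 fun a _ => ?_
  obtain ⟨t, rfl⟩ := RingQuot.mkAlgHom_surjective ℝ (SymRel V) a
  induction t using TensorAlgebra.induction with
  | algebraMap r =>
    rw [AlgHom.commutes, Algebra.algebraMap_eq_smul_one]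
    exact Submodule.smul_mem _ _ (Submodule.subset_span ⟨[], by simp [monomial]⟩)
  | ι v =>
    induction v using DirectSum.induction_on with
    | zero => simp
    | of i α => exact hgen i α
    | add v w hv hw => rw [map_add, map_add]; exact add_mem (hv trivial) (hw trivial)
  | mul a b ha hb => rw [map_mul]; exact hmul _ _ (ha trivial) (hb trivial)
  | add a b ha hb => rw [map_add]; exact add_mem (ha trivial) (hb trivial)

/-- An algebra map that preserves the bidegrees of the generators preserves all bidegrees. -/
theorem map_homog_of_gen {V W : GradedSuperSpace} (f : W.Sym →ₐ[ℝ] V.Sym)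
    (hf : ∀ i α, f (W.gen i α) ∈ V.homog (shift i)) {i : ℕ × ZMod 2} {a : W.Sym}
    (ha : a ∈ W.homog i) : f a ∈ V.homog i := by
  have h : ∀ l, f (W.monomial l) ∈ V.homog (W.monomialDegree l) := by
    intro l
    induction l with
    | nil => simpa [monomial, monomialDegree] using V.one_mem_homog
    | cons x l ih =>
      simp only [monomial, monomialDegree, List.map_cons, List.prod_cons, List.sum_cons,
        map_mul] at ih ⊢
      exact V.mul_mem_homog (hf _ _) ih
  induction ha using Submodule.span_induction with
  | zero => simp
  | add x y _ _ hx hy => rw [map_add]; exact add_mem hx hy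
  | smul r x _ hx => rw [map_smul]; exact Submodule.smul_mem _ _ hx
  | mem x hx =>
    obtain ⟨l, rfl, rfl⟩ := hx
    exact h l

/-- The differential of a semi-free differential graded commutative superalgebra: a derivation of
bidegree `(1, even)` of the free graded commutative superalgebra on `V[1]^*` that squares to zero. -/
@[ext]
structure Differential (V : GradedSuperSpace) where
  d : V.Sym →ₗ[ℝ] V.Sym
  map_homog : ∀ (k : ℕ) (s : ZMod 2) (a : V.Sym), a ∈ V.homog (k, s) → d a ∈ V.homog (k + 1, s)
  leibniz : ∀ (k : ℕ) (s : ZMod 2) (a b : V.Sym), a ∈ V.homog (k, s) →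
    d (a * b) = d a * b + (-1 : ℝ) ^ k • (a * d b)
  sq_zero : ∀ a, d (d a) = 0

theorem Differential.d_one {V : GradedSuperSpace} (D : V.Differential) : D.d 1 = 0 := by
  have h := D.leibniz 0 0 1 1 V.one_mem_homog
  simpa using h

/-- The zero differential. -/
def zeroDifferential (V : GradedSuperSpace) : V.Differential where
  d := 0
  map_homog := by simp
  leibniz := by simp
  sq_zero := by simp

/-- The coordinate on the line: the identity of `ℝ` on the component `(n, even)`, and zero on the other
components. -/
def lineCoord (n : ℕ) (i : ℕ × ZMod 2) : Module.Dual ℝ ((line n).carrier i.1 i.2) :=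
  Submodule.subtype (if i.1 = n ∧ i.2 = 0 then ⊤ else ⊥ : Submodule ℝ ℝ)

/-- The generator of bidegree `(n + 1, even)` of the free algebra on `ℝ[n][1]^*`: the identity
of `ℝ` as a linear form on the component of homological degree `n`. -/
def lineGen (n : ℕ) : (line n).Sym := (line n).gen (n, 0) (lineCoord n (n, 0))

/-- The element `1` of the component `(n, even)` of the line, and `0` in the other components. -/
def lineUnit (n : ℕ) (i : ℕ × ZMod 2) : (line n).carrier i.1 i.2 :=
  (⟨if i.1 = n ∧ i.2 = 0 then 1 else 0, by split_ifs <;> simp⟩ :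
    (if i.1 = n ∧ i.2 = 0 then ⊤ else ⊥ : Submodule ℝ ℝ))

theorem lineUnit_of_ne (n : ℕ) (i : ℕ × ZMod 2) (h : i ≠ (n, 0)) : lineUnit n i = 0 :=
  Subtype.ext (if_neg fun h' => h (Prod.ext h'.1 h'.2))

theorem lineCoord_lineUnit (n : ℕ) : lineCoord n (n, 0) (lineUnit n (n, 0)) = 1 :=
  if_pos ⟨rfl, rfl⟩

/-- The algebra map out of the free algebra on one generator with a given value on the generator. -/
def lineLift (V : GradedSuperSpace) (n : ℕ) (μ : V.Sym) (hμ : μ ∈ V.homog (n + 1, 0)) :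
    (line n).Sym →ₐ[ℝ] V.Sym :=
  (line n).lift (DirectSum.toModule ℝ _ _ fun i =>
      (LinearMap.toSpanSingleton ℝ V.Sym μ) ∘ₗ
        (Module.Dual.eval ℝ ((line n).carrier i.1 i.2) (lineUnit n i))) (by
    intro i j α β
    simp only [inDual, DirectSum.toModule_lof]
    by_cases hi : i = (n, 0)
    · by_cases hj : j = (n, 0)
      · subst hi hj
        have h := V.mul_comm_of_mem_homog hμ hμ
        simp only [LinearMap.comp_apply, Module.Dual.eval_apply,
          LinearMap.toSpanSingleton_apply, smul_mul_smul_comm]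
        conv_lhs => rw [h]
        rw [smul_comm, mul_comm]
        rfl
      · simp [lineUnit_of_ne n j hj]
    · simp [lineUnit_of_ne n i hi])

theorem lineLift_gen (V : GradedSuperSpace) (n : ℕ) (μ : V.Sym) (hμ : μ ∈ V.homog (n + 1, 0))
    (i : ℕ × ZMod 2) (α : Module.Dual ℝ ((line n).carrier i.1 i.2)) :
    V.lineLift n μ hμ ((line n).gen i α) = α (lineUnit n i) • μ := by
  simp only [lineLift, gen, lift_gens, inDual, DirectSum.toModule_lof]
  rfl

theorem lineLift_lineGen (V : GradedSuperSpace) (n : ℕ) (μ : V.Sym)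
    (hμ : μ ∈ V.homog (n + 1, 0)) : V.lineLift n μ hμ (lineGen n) = μ := by
  rw [lineGen, lineLift_gen, lineCoord_lineUnit, one_smul]

theorem lineLift_mem_homog (V : GradedSuperSpace) (n : ℕ) (μ : V.Sym)
    (hμ : μ ∈ V.homog (n + 1, 0)) {i : ℕ × ZMod 2} {a : (line n).Sym}
    (ha : a ∈ (line n).homog i) : V.lineLift n μ hμ a ∈ V.homog i := by
  refine map_homog_of_gen _ (fun j α => ?_) ha
  rw [lineLift_gen]
  by_cases hj : j = (n, 0)
  · subst hj
    exact Submodule.smul_mem _ _ hμ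
  · rw [lineUnit_of_ne n j hj, map_zero, zero_smul]
    exact zero_mem _

theorem Differential.d_lineLift {V : GradedSuperSpace} (D : V.Differential) (n : ℕ) (μ : V.Sym)
    (hμ : μ ∈ V.homog (n + 1, 0)) (hd : D.d μ = 0) (a : (line n).Sym) :
    D.d (V.lineLift n μ hμ a) = 0 := by
  have ha : a ∈ Submodule.span ℝ (Set.range (line n).monomial) := by
    rw [span_monomials]; trivial
  induction ha using Submodule.span_induction with
  | zero => simp
  | add x y _ _ hx hy => rw [map_add, map_add, hx, hy, add_zero]
  | smul r x _ hx => rw [map_smul, map_smul, hx, smul_zero]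
  | mem x hx =>
    obtain ⟨l, rfl⟩ := hx
    induction l with
    | nil => simpa [monomial] using D.d_one
    | cons y l ih =>
      simp only [monomial, List.map_cons, List.prod_cons, map_mul] at ih ⊢
      rw [lineLift_gen, smul_mul_assoc, map_smul, D.leibniz _ _ _ _ hμ, ih, hd]
      simp

end GradedSuperSpace

open GradedSuperSpace

/-! ### Super `L_∞`-algebras -/

/-- A super `L_∞`-algebra of finite type: a graded super vector space `g` with the
structure given by the differential of its Chevalley--Eilenberg algebra, whose underlying
algebra is the free graded commutative superalgebra on `g[1]^*`. The component of the differential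
from generators to `i`-fold products of generators is the transpose of the `i`-ary bracket. -/
structure SuperLInfAlgebra where
  space : GradedSuperSpace
  diff : space.Differential

namespace SuperLInfAlgebra

/-- The Chevalley--Eilenberg algebra. -/
abbrev CE (g : SuperLInfAlgebra) : Type := g.space.Sym

/-- The Chevalley--Eilenberg differential. -/
abbrev d (g : SuperLInfAlgebra) : g.CE →ₗ[ℝ] g.CE := g.diff.d

/-- A homomorphism of super `L_∞`-algebras `g → h` is a homomorphism of differential graded
superalgebras `CE(h) → CE(g)`. -/
@[ext]
structure Hom (g h : SuperLInfAlgebra) where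
  toAlgHom : h.CE →ₐ[ℝ] g.CE
  map_homog : ∀ i a, a ∈ h.space.homog i → toAlgHom a ∈ g.space.homog i
  map_d : ∀ a, toAlgHom (h.d a) = g.d (toAlgHom a)

instance : Category SuperLInfAlgebra where
  Hom := Hom
  id g := ⟨AlgHom.id ℝ g.CE, fun _ _ h => h, fun _ => rfl⟩
  comp f f' := ⟨f.toAlgHom.comp f'.toAlgHom,
    fun i a h => f.map_homog i _ (f'.map_homog i a h),
    fun a => by simp [f'.map_d, f.map_d]⟩

/-- The trivial `L_∞`-algebra. -/
def point : SuperLInfAlgebra := ⟨zero, zero.zeroDifferential⟩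

/-- The abelian `L_∞`-algebra `ℝ[n]`: its Chevalley--Eilenberg algebra is free on a
single closed generator of bidegree `(n + 1, even)`. -/
def lineAlgebra (n : ℕ) : SuperLInfAlgebra := ⟨line n, (line n).zeroDifferential⟩

/-- The transpose `g[1]^* → g[1]^*` of the unary bracket: the linear component of the
Chevalley--Eilenberg differential. -/
def unary (g : SuperLInfAlgebra) : g.space.ShiftedDual →ₗ[ℝ] g.space.ShiftedDual :=
  g.space.linearPart ∘ₗ g.d ∘ₗ g.space.gens

/-- The transpose `h[1]^* → g[1]^*` of the linear component `g → h` of an `L_∞`-homomorphism. -/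
def Hom.linear {g h : SuperLInfAlgebra} (f : Hom g h) :
    h.space.ShiftedDual →ₗ[ℝ] g.space.ShiftedDual :=
  g.space.linearPart ∘ₗ f.toAlgHom.toLinearMap ∘ₗ h.space.gens

/-- A weak equivalence (`L_∞`-quasi-isomorphism): the linear component `g → h` is a
quasi-isomorphism of the chain complexes given by the unary brackets. As the complexes are
degreewise finite-dimensional, this is stated for the transposed map of dual complexes: it is injective
and surjective on cohomology. -/
def IsWeakEquivalence {g h : SuperLInfAlgebra} (f : g ⟶ h) : Prop :=
  (∀ v, h.unary v = 0 → (∃ u, Hom.linear f v = g.unary u) → ∃ u', v = h.unary u') ∧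
  (∀ w, g.unary w = 0 → ∃ v, h.unary v = 0 ∧ ∃ u, w = Hom.linear f v + g.unary u)

/-- A fibration: the linear component `g → h` is surjective, that is, its transpose is
injective. -/
def IsFibration {g h : SuperLInfAlgebra} (f : g ⟶ h) : Prop :=
  Function.Injective (Hom.linear f)

/-- Equivalence of `L_∞`-algebras over `g`: there is a zigzag of weak equivalences over `g`. -/
def EquivalentOver {g : SuperLInfAlgebra} (x y : Over g) : Prop :=
  Relation.EqvGen (fun a b : Over g => ∃ f : a ⟶ b, IsWeakEquivalence f.left) x y

/-- `p : k ⟶ g` is a homotopy fiber of `f : g ⟶ h`: up to equivalence over `g` it is the strict pullback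
along `f` of a fibration `q : e ⟶ h` that replaces the map from the point, in the sense that the map
from the point to `h` factors as a weak equivalence `point ⟶ e` followed by `q`. -/
def IsHomotopyFiber {k g h : SuperLInfAlgebra} (f : g ⟶ h) (p : k ⟶ g) : Prop :=
  ∃ (e k' : SuperLInfAlgebra) (i : point ⟶ e) (q : e ⟶ h) (t : k' ⟶ e) (p' : k' ⟶ g),
    IsWeakEquivalence i ∧ IsFibration q ∧ IsPullback t p' q f ∧
      EquivalentOver (Over.mk p) (Over.mk p')

/-- A cocycle of degree `m` on `g`: a closed (even) element of degree `m` of the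
Chevalley--Eilenberg algebra. -/
structure IsCocycle (g : SuperLInfAlgebra) (m : ℕ) (μ : g.CE) : Prop where
  mem_homog : μ ∈ g.space.homog (m, 0)
  closed : g.d μ = 0

/-- A cocycle of degree `n + 1` as a homomorphism `g ⟶ ℝ[n]`: the homomorphism of differential
graded algebras that sends the generator to the cocycle. -/
def IsCocycle.hom {g : SuperLInfAlgebra} {n : ℕ} {μ : g.CE} (hμ : g.IsCocycle (n + 1) μ) :
    g ⟶ lineAlgebra n :=
  Hom.mk (g := g) (h := lineAlgebra n) (g.space.lineLift n μ hμ.mem_homog)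
    (fun _ _ ha => g.space.lineLift_mem_homog n μ hμ.mem_homog ha)
    (fun a => ((g.space.lineLift n μ hμ.mem_homog).map_zero).trans
      (g.diff.d_lineLift n μ hμ.mem_homog hμ.closed a).symm)

theorem IsCocycle.hom_lineGen {g : SuperLInfAlgebra} {n : ℕ} {μ : g.CE}
    (hμ : g.IsCocycle (n + 1) μ) : hμ.hom.toAlgHom (lineGen n) = μ :=
  g.space.lineLift_lineGen n μ hμ.mem_homog

/-! ### Adjoining a generator -/

/-- The underlying graded super vector space of the extension, `g ⊕ ℝ[n-1]`; its dual, shifted,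
is `g[1]^*` with one even generator of degree `n` adjoined (for `1 ≤ n`). -/
def extSpace (g : SuperLInfAlgebra) (n : ℕ) : GradedSuperSpace := g.space.sum (line (n - 1))

/-- The first projection of the direct sum. -/
def extFst (g : SuperLInfAlgebra) (n k : ℕ) (s : ZMod 2) :
    (g.extSpace n).carrier k s →ₗ[ℝ] g.space.carrier k s :=
  LinearMap.fst ℝ (g.space.carrier k s) ((line (n - 1)).carrier k s)

/-- The second projection of the direct sum. -/
def extSnd (g : SuperLInfAlgebra) (n k : ℕ) (s : ZMod 2) :
    (g.extSpace n).carrier k s →ₗ[ℝ] (line (n - 1)).carrier k s :=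
  LinearMap.snd ℝ (g.space.carrier k s) ((line (n - 1)).carrier k s)

/-- The inclusion of `CE(g)` into the graded algebra with one generator adjoined. -/
def extIncl (g : SuperLInfAlgebra) (n : ℕ) : g.CE →ₐ[ℝ] (g.extSpace n).Sym :=
  symMap (g.extFst n)

/-- The adjoined generator `c_n`, of bidegree `((n - 1) + 1, even)`, which is `(n, even)` for `1 ≤ n`. -/
def extGen (g : SuperLInfAlgebra) (n : ℕ) : (g.extSpace n).Sym :=
  symMap (g.extSnd n) (lineGen (n - 1))

/-- A differential on the graded algebra `CE(g)` with one generator `c_n` adjoined is the one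
prescribed by `d c_n = μ` if it restricts to the differential of `CE(g)` and maps `c_n` to `μ`. -/
def IsExtDifferential (g : SuperLInfAlgebra) (n : ℕ) (μ : g.CE)
    (D : (g.extSpace n).Differential) : Prop :=
  (∀ a, D.d (g.extIncl n a) = g.extIncl n (g.d a)) ∧ D.d (g.extGen n) = g.extIncl n μ

/-- The homomorphism to `g` dual to the inclusion of `CE(g)`. -/
def IsExtDifferential.proj {g : SuperLInfAlgebra} {n : ℕ} {μ : g.CE}
    {D : (g.extSpace n).Differential} (hD : g.IsExtDifferential n μ D) :
    SuperLInfAlgebra.mk (g.extSpace n) D ⟶ g :=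
  Hom.mk (g := SuperLInfAlgebra.mk (g.extSpace n) D) (h := g) (g.extIncl n)
    (fun i a ha => map_homog_of_gen (V := g.extSpace n) (W := g.space) _ (fun j α => by
      rw [extIncl, symMap_gen]
      exact gen_mem_homog _ _ _) ha)
    (fun a => (hD.1 a).symm)

end SuperLInfAlgebra

end

/-! A derivation of a free graded commutative algebra can be prescribed on generators, is determined
there, and squares to zero once it does so there. This gives the unique differential with `d c_n =
μ`; closedness of `μ` is exactly the condition at `c_n`.

A homomorphism `k ⟶ g_μ` amounts to a homomorphism `p : k ⟶ g` with an element `γ` of degree `n`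
such that `d γ` is the pullback of `μ` along `p`. Hence `g_μ` is the strict pullback along `μ` of
the universal case: the extension `e₀` of `ℝ[n]` by its own generator, with generators `b`, `c` and
`d c = b`. The algebra `e₀` is acyclic and `e₀ ⟶ ℝ[n]` is a fibration, so `g_μ` is a homotopy fiber.

For uniqueness, let `q : e ⟶ ℝ[n]` be any fibration with `e` acyclic, and `k'` its pullback along
`μ`. Instead of a model structure, the proof uses an explicit isomorphism `e × e₀ ≅ e₀ × lin e` over
`ℝ[n]`, where `lin e` keeps only the unary bracket of `e` (`exists_isIso_prod`). Pulled back along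
`μ` it becomes `k' × e₀ ≅ g_μ × lin e` over `g`. Projecting away an acyclic factor is a weak
equivalence, so this is a zigzag from `k'` to `g_μ`.

The isomorphism rests on three facts. Acyclicity kills the cohomology of `CE(e)` in positive degrees
(`IsAcyclic.exists_eq_d`), so the pullback of `b` is some `d γ` and `q` lifts to `r : e ⟶ e₀`. A
contraction of the unary bracket gives a homomorphism `e ⟶ lin e` with identity linear component;
since `r` and this map ignore the factor `e₀`, it is corrected by terms involving `b` and `c`
(`exists_hom_linearization`). Finally, a homomorphism with bijective linear component is an
isomorphism (`isIso_of_linear_bijective`). The first and last facts use that generators have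
positive degree: a product has at most as many factors as its degree. -/

noncomputable section

open GradedSuperSpace

/-! ### Derivations and differentials on the free graded commutative algebra. -/

namespace GradedSuperSpace

variable {V W : GradedSuperSpace}

theorem monomial_nil : V.monomial [] = 1 := rfl

theorem monomial_cons (x : Σ i : ℕ × ZMod 2, Module.Dual ℝ (V.carrier i.1 i.2)) (l : List _) :
    V.monomial (x :: l) = V.gen x.1 x.2 * V.monomial l := by
  simp [monomial]

theorem monomialDegree_nil : V.monomialDegree [] = 0 := rfl

theorem monomialDegree_cons (x : Σ i : ℕ × ZMod 2, Module.Dual ℝ (V.carrier i.1 i.2))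
    (l : List _) : V.monomialDegree (x :: l) = shift x.1 + V.monomialDegree l := by
  simp [monomialDegree]

theorem monomial_mem_homog (l : List (Σ i : ℕ × ZMod 2, Module.Dual ℝ (V.carrier i.1 i.2))) :
    V.monomial l ∈ V.homog (V.monomialDegree l) :=
  Submodule.subset_span ⟨l, rfl, rfl⟩

theorem linearMap_ext_monomial {M : Type*} [AddCommMonoid M] [Module ℝ M] {f g : V.Sym →ₗ[ℝ] M}
    (h : ∀ l, f (V.monomial l) = g (V.monomial l)) : f = g :=
  LinearMap.ext_on_range V.span_monomials h

/-- A linear map on the space of generators is determined by its values on homogeneous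
generators. -/
theorem shiftedDual_hom_ext {M : Type*} [AddCommMonoid M] [Module ℝ M]
    {f g : V.ShiftedDual →ₗ[ℝ] M} (h : ∀ i α, f (V.inDual i α) = g (V.inDual i α)) : f = g :=
  DirectSum.linearMap_ext _ fun i => LinearMap.ext fun α => h i α

/-- Algebra maps out of the free algebra agree if they agree on homogeneous generators. -/
theorem hom_ext_gen {A : Type} [Ring A] [Algebra ℝ A] {f g : V.Sym →ₐ[ℝ] A}
    (h : ∀ i α, f (V.gen i α) = g (V.gen i α)) : f = g :=
  V.hom_ext fun v => LinearMap.congr_fun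
    (shiftedDual_hom_ext (f := f.toLinearMap ∘ₗ V.gens) (g := g.toLinearMap ∘ₗ V.gens) h) v

/-- A linear map of bidegree zero from generators extends to an algebra map. -/
def liftGraded (f : W.ShiftedDual →ₗ[ℝ] V.Sym)
    (hf : ∀ i α, f (W.inDual i α) ∈ V.homog (shift i)) : W.Sym →ₐ[ℝ] V.Sym :=
  W.lift f fun i j α β => V.mul_comm_of_mem_homog (hf i α) (hf j β)

theorem liftGraded_gens (f : W.ShiftedDual →ₗ[ℝ] V.Sym) (hf) (v : W.ShiftedDual) :
    liftGraded f hf (W.gens v) = f v :=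
  W.lift_gens _ _ _

theorem liftGraded_mem_homog (f : W.ShiftedDual →ₗ[ℝ] V.Sym) (hf) {i : ℕ × ZMod 2} {a : W.Sym}
    (ha : a ∈ W.homog i) : liftGraded f hf a ∈ V.homog i :=
  map_homog_of_gen _ (fun i α => by rw [gen, liftGraded_gens]; exact hf i α) ha

/-- The algebra automorphism that multiplies the elements of cohomological degree `k` by
`(-1)^k`. -/
def gradeInvolution (V : GradedSuperSpace) : V.Sym →ₐ[ℝ] V.Sym :=
  symMap fun k s => ((-1 : ℝ) ^ (k + 1)) • (LinearMap.id : V.carrier k s →ₗ[ℝ] V.carrier k s)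

theorem gradeInvolution_gen (i : ℕ × ZMod 2) (α : Module.Dual ℝ (V.carrier i.1 i.2)) :
    V.gradeInvolution (V.gen i α) = (-1 : ℝ) ^ (i.1 + 1) • V.gen i α := by
  rw [gradeInvolution, symMap_gen, LinearMap.comp_smul, LinearMap.comp_id]
  simp [gen]

theorem gradeInvolution_of_mem_homog {k : ℕ} {s : ZMod 2} {a : V.Sym} (ha : a ∈ V.homog (k, s)) :
    V.gradeInvolution a = (-1 : ℝ) ^ k • a := by
  have h : ∀ l, V.gradeInvolution (V.monomial l) =
      (-1 : ℝ) ^ (V.monomialDegree l).1 • V.monomial l := by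
    intro l
    induction l with
    | nil => simp [monomial_nil, monomialDegree_nil]
    | cons x l ih =>
      rw [monomial_cons, monomialDegree_cons, map_mul, ih, gradeInvolution_gen,
        smul_mul_smul_comm, ← pow_add]
      rfl
  induction ha using Submodule.span_induction with
  | zero => simp
  | add x y _ _ hx hy => rw [map_add, hx, hy, smul_add]
  | smul r x _ hx => rw [map_smul, hx, smul_comm]
  | mem x hx =>
    obtain ⟨l, hl, rfl⟩ := hx
    rw [h, hl]

/-- A derivation of odd cohomological degree and even parity. -/
def IsOddDerivation (δ : V.Sym →ₗ[ℝ] V.Sym) : Prop :=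
  ∀ (k : ℕ) (s : ZMod 2) (a b : V.Sym), a ∈ V.homog (k, s) →
    δ (a * b) = δ a * b + (-1 : ℝ) ^ k • (a * δ b)

theorem Differential.isOddDerivation (D : V.Differential) : IsOddDerivation D.d :=
  D.leibniz

theorem IsOddDerivation.map_one {δ : V.Sym →ₗ[ℝ] V.Sym} (hδ : IsOddDerivation δ) : δ 1 = 0 := by
  have h := hδ 0 0 1 1 V.one_mem_homog
  simpa using h

theorem IsOddDerivation.map_gen_mul {δ : V.Sym →ₗ[ℝ] V.Sym} (hδ : IsOddDerivation δ)
    (i : ℕ × ZMod 2) (α : Module.Dual ℝ (V.carrier i.1 i.2)) (b : V.Sym) :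
    δ (V.gen i α * b) = δ (V.gen i α) * b + (-1 : ℝ) ^ (i.1 + 1) • (V.gen i α * δ b) :=
  hδ _ _ _ _ (V.gen_mem_homog i α)

theorem IsOddDerivation.ext {δ δ' : V.Sym →ₗ[ℝ] V.Sym} (hδ : IsOddDerivation δ)
    (hδ' : IsOddDerivation δ') (h : ∀ i α, δ (V.gen i α) = δ' (V.gen i α)) : δ = δ' := by
  refine linearMap_ext_monomial fun l => ?_
  induction l with
  | nil => rw [monomial_nil, hδ.map_one, hδ'.map_one]
  | cons x l ih => rw [monomial_cons, hδ.map_gen_mul, hδ'.map_gen_mul, ih, h]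

/-- An algebra map of bidegree zero intertwines odd derivations if it does so on generators. -/
theorem IsOddDerivation.intertwine {δ : W.Sym →ₗ[ℝ] W.Sym} {δ' : V.Sym →ₗ[ℝ] V.Sym}
    (hδ : IsOddDerivation δ) (hδ' : IsOddDerivation δ') (f : W.Sym →ₐ[ℝ] V.Sym)
    (hf : ∀ i α, f (W.gen i α) ∈ V.homog (shift i))
    (h : ∀ i α, f (δ (W.gen i α)) = δ' (f (W.gen i α))) (a : W.Sym) : f (δ a) = δ' (f a) := by
  refine LinearMap.congr_fun (f := f.toLinearMap ∘ₗ δ) (g := δ' ∘ₗ f.toLinearMap)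
    (linearMap_ext_monomial fun l => ?_) a
  simp only [LinearMap.comp_apply, AlgHom.toLinearMap_apply]
  induction l with
  | nil => rw [monomial_nil, hδ.map_one, _root_.map_one, hδ'.map_one, map_zero]
  | cons x l ih =>
    rw [monomial_cons, hδ.map_gen_mul, map_mul, hδ' _ _ _ _ (hf x.1 x.2), ← ih, ← h]
    simp

/-- If `l` and `j` have opposite parities then `k * j + k` and `k * l` agree modulo 2. This absorbs
the Leibniz sign when an element moves past the value of an odd derivation. -/
theorem neg_one_pow_eq_koszulSign_mul {k l j : ℕ} {s t : ZMod 2} (h : Odd (l + j)) :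
    (-1 : ℝ) ^ k * koszulSign (k, s) (j, t) = koszulSign (k, s) (l, t) := by
  simp only [koszulSign, ← pow_add]
  apply neg_one_pow_congr
  have h1 : Even (k * (l + j) + k) := by
    obtain ⟨c, hc⟩ := h
    rw [hc]
    exact ⟨k * (c + 1), by ring⟩
  have h2 := h1
  rw [Nat.even_iff] at h2
  rw [Nat.even_iff, Nat.even_iff]
  ring_nf at h2 ⊢
  omega

/-- Every linear map of odd degree and even parity from generators extends to an odd
derivation. -/
theorem exists_isOddDerivation (θ : V.ShiftedDual →ₗ[ℝ] V.Sym)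
    (hθ : ∀ i : ℕ × ZMod 2, ∃ j, Odd (i.1 + 1 + j) ∧ ∀ α, θ (V.inDual i α) ∈ V.homog (j, i.2)) :
    ∃ δ : V.Sym →ₗ[ℝ] V.Sym, IsOddDerivation δ ∧ ∀ v, δ (V.gens v) = θ v := by
  -- The map `a ↦ !![ι a, δ a; 0, a]`, with `ι` the grade involution, is multiplicative exactly when
  -- `δ` satisfies the signed Leibniz rule. Extending `θ` to a derivation thus becomes extending an
  -- algebra map, and only graded commutation of the matrices on generators is to be checked.
  let f : V.ShiftedDual →ₗ[ℝ] Matrix (Fin 2) (Fin 2) V.Sym :=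
    { toFun := fun v => !![V.gradeInvolution (V.gens v), θ v; 0, V.gens v]
      map_add' := fun v w => by
        ext i j; fin_cases i <;> fin_cases j <;> simp
      map_smul' := fun r v => by
        ext i j; fin_cases i <;> fin_cases j <;> simp }
  have hf (v) : f v = !![V.gradeInvolution (V.gens v), θ v; 0, V.gens v] := rfl
  have hcomm : ∀ i j α β, f (V.inDual i α) * f (V.inDual j β) =
      koszulSign (shift i) (shift j) • (f (V.inDual j β) * f (V.inDual i α)) := by
    intro i j α β
    have hg : ∀ i α, V.gradeInvolution (V.gens (V.inDual i α)) =
      (-1 : ℝ) ^ (i.1 + 1) • V.gens (V.inDual i α) := fun i α => gradeInvolution_gen i α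
    have hc : V.gens (V.inDual i α) * V.gens (V.inDual j β) = koszulSign (shift i) (shift j) •
      (V.gens (V.inDual j β) * V.gens (V.inDual i α)) := V.gen_comm i j α β
    -- The upper right entry is the only one that involves `θ`; the parity assumption on the degrees
    -- of its values makes the two signs match.
    have h01 : V.gradeInvolution (V.gens (V.inDual i α)) * θ (V.inDual j β) +
        θ (V.inDual i α) * V.gens (V.inDual j β) = koszulSign (shift i) (shift j) •
        (V.gradeInvolution (V.gens (V.inDual j β)) * θ (V.inDual i α) +
        θ (V.inDual j β) * V.gens (V.inDual i α)) := by
      obtain ⟨j', hj', hj⟩ := hθ j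
      obtain ⟨i', hi', hi⟩ := hθ i
      rw [hg, hg, smul_mul_assoc, smul_mul_assoc,
        show V.gens (V.inDual i α) * θ (V.inDual j β) = _ from
          V.mul_comm_of_mem_homog (V.gen_mem_homog i α) (hj β),
        show V.gens (V.inDual j β) * θ (V.inDual i α) = _ from
          V.mul_comm_of_mem_homog (V.gen_mem_homog j β) (hi α), smul_smul, smul_smul]
      simp only [shift]
      rw [neg_one_pow_eq_koszulSign_mul hj', neg_one_pow_eq_koszulSign_mul hi', smul_add,
        smul_smul, koszulSign_comm (j.1 + 1, j.2), koszulSign_mul_self, one_smul, add_comm]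
    rw [hf, hf]
    ext a b
    fin_cases a <;> fin_cases b
    · simp [Matrix.mul_apply, ← map_mul, hc]
    · simpa [Matrix.mul_apply] using h01
    · simp [Matrix.mul_apply]
    · simp [Matrix.mul_apply, hc]
  let Φ := V.lift f hcomm
  have hΦ : ∀ v, Φ (V.gens v) = f v := V.lift_gens f hcomm
  have key : ∀ l, Φ (V.monomial l) 1 0 = 0 ∧ Φ (V.monomial l) 1 1 = V.monomial l ∧
      Φ (V.monomial l) 0 0 = V.gradeInvolution (V.monomial l) := by
    intro l
    induction l with
    | nil => simp [monomial_nil]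
    | cons x l ih =>
      obtain ⟨h1, h2, h3⟩ := ih
      rw [monomial_cons, map_mul, map_mul, gen, hΦ, hf]
      simp [Matrix.mul_apply, h1, h2, h3]
  have h11 : ∀ a, Φ a 1 1 = a := fun a => LinearMap.congr_fun
    (f := Matrix.entryLinearMap ℝ V.Sym 1 1 ∘ₗ Φ.toLinearMap) (g := LinearMap.id)
    (linearMap_ext_monomial fun l => (key l).2.1) a
  have h00 : ∀ a, Φ a 0 0 = V.gradeInvolution a := fun a => LinearMap.congr_fun
    (f := Matrix.entryLinearMap ℝ V.Sym 0 0 ∘ₗ Φ.toLinearMap) (g := V.gradeInvolution.toLinearMap)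
    (linearMap_ext_monomial fun l => (key l).2.2) a
  refine ⟨Matrix.entryLinearMap ℝ V.Sym 0 1 ∘ₗ Φ.toLinearMap, fun k s a b ha => ?_, fun v => ?_⟩
  · simp only [LinearMap.comp_apply, AlgHom.toLinearMap_apply, map_mul,
      Matrix.entryLinearMap_apply, Matrix.mul_apply, Fin.sum_univ_two, h11, h00]
    rw [gradeInvolution_of_mem_homog ha, smul_mul_assoc, add_comm]
  · simp [hΦ, hf]

theorem IsOddDerivation.map_homog {δ : V.Sym →ₗ[ℝ] V.Sym} (hδ : IsOddDerivation δ)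
    (h : ∀ (i : ℕ × ZMod 2) α, δ (V.gen i α) ∈ V.homog (i.1 + 1 + 1, i.2)) (k : ℕ) (s : ZMod 2)
    (a : V.Sym) (ha : a ∈ V.homog (k, s)) : δ a ∈ V.homog (k + 1, s) := by
  have hl : ∀ l, δ (V.monomial l) ∈ V.homog (V.monomialDegree l + (1, 0)) := by
    intro l
    induction l with
    | nil => rw [monomial_nil, hδ.map_one]; exact zero_mem _
    | cons x l ih =>
      rw [monomial_cons, monomialDegree_cons, hδ.map_gen_mul]
      refine add_mem ?_ (Submodule.smul_mem _ _ ?_)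
      · have := V.mul_mem_homog (h x.1 x.2) (monomial_mem_homog l)
        convert this using 2
        ext <;> simp [shift]; ring
      · have := V.mul_mem_homog (V.gen_mem_homog x.1 x.2) ih
        rwa [← add_assoc] at this
  induction ha using Submodule.span_induction with
  | zero => simp
  | add x y _ _ hx hy => rw [map_add]; exact add_mem hx hy
  | smul r x _ hx => rw [map_smul]; exact Submodule.smul_mem _ _ hx
  | mem x hx =>
    obtain ⟨l, hl', rfl⟩ := hx
    have := hl l
    rwa [hl', Prod.mk_add_mk, add_zero] at this

/-- The cross terms in `δ (δ (x * b))` cancel, because `δ x` has degree one more than `x`. So only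
the values on generators matter. -/
theorem IsOddDerivation.sq_zero {δ : V.Sym →ₗ[ℝ] V.Sym} (hδ : IsOddDerivation δ)
    (h : ∀ (i : ℕ × ZMod 2) α, δ (V.gen i α) ∈ V.homog (i.1 + 1 + 1, i.2))
    (h2 : ∀ i α, δ (δ (V.gen i α)) = 0) (a : V.Sym) : δ (δ a) = 0 := by
  refine LinearMap.congr_fun (f := δ ∘ₗ δ) (g := 0) (linearMap_ext_monomial fun l => ?_) a
  simp only [LinearMap.comp_apply, LinearMap.zero_apply]
  induction l with
  | nil => rw [monomial_nil, hδ.map_one, map_zero]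
  | cons x l ih =>
    rw [monomial_cons, hδ.map_gen_mul, map_add, map_smul, hδ _ _ _ _ (h x.1 x.2),
      hδ.map_gen_mul, ih, h2, pow_succ _ (x.1.1 + 1)]
    simp only [zero_mul, mul_neg, mul_one, zero_add, mul_zero, smul_zero, add_zero]
    rw [← add_smul, neg_add_cancel, zero_smul]

/-- A linear map of bidegree `(1, even)` from generators that squares to zero extends to a
differential. -/
theorem exists_differential (θ : V.ShiftedDual →ₗ[ℝ] V.Sym)
    (hθ : ∀ i α, θ (V.inDual i α) ∈ V.homog (i.1 + 1 + 1, i.2))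
    (h2 : ∀ δ : V.Sym →ₗ[ℝ] V.Sym, IsOddDerivation δ → (∀ v, δ (V.gens v) = θ v) →
      ∀ i α, δ (θ (V.inDual i α)) = 0) :
    ∃ D : V.Differential, ∀ v, D.d (V.gens v) = θ v := by
  obtain ⟨δ, hδ, h⟩ := exists_isOddDerivation θ fun i => ⟨i.1 + 1 + 1, ⟨i.1 + 1, by ring⟩, hθ i⟩
  have hg : ∀ (i : ℕ × ZMod 2) α, δ (V.gen i α) ∈ V.homog (i.1 + 1 + 1, i.2) := fun i α => by
    rw [gen, h]; exact hθ i α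
  exact ⟨⟨δ, hδ.map_homog hg, hδ, hδ.sq_zero hg fun i α => by rw [gen, h]; exact h2 δ hδ h i α⟩, h⟩

end GradedSuperSpace

namespace SuperLInfAlgebra

variable {g h : SuperLInfAlgebra}

/-- A homomorphism from its values on generators. -/
def Hom.ofGens (f : h.space.ShiftedDual →ₗ[ℝ] g.CE)
    (hf : ∀ i α, f (h.space.inDual i α) ∈ g.space.homog (shift i))
    (hd : ∀ i α, liftGraded f hf (h.d (h.space.gen i α)) = g.d (f (h.space.inDual i α))) :
    g ⟶ h :=
  Hom.mk (g := g) (h := h) (liftGraded f hf) (fun _ _ => liftGraded_mem_homog f hf)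
    (h.diff.isOddDerivation.intertwine g.diff.isOddDerivation _
      (fun i α => by rw [gen, liftGraded_gens]; exact hf i α)
      (fun i α => by rw [hd, gen, liftGraded_gens]))

/-- Homomorphisms agree if they agree on generators. -/
theorem hom_ext_gen {f f' : g ⟶ h}
    (H : ∀ i α, Hom.toAlgHom f (h.space.gen i α) = Hom.toAlgHom f' (h.space.gen i α)) : f = f' :=
  Hom.ext (GradedSuperSpace.hom_ext_gen H)

theorem comp_toAlgHom_apply {k : SuperLInfAlgebra} (f : g ⟶ h) (f' : h ⟶ k) (a : k.CE) :
    Hom.toAlgHom (f ≫ f') a = Hom.toAlgHom f (Hom.toAlgHom f' a) := rfl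

end SuperLInfAlgebra
-- Word length, linear components, and inverting algebra maps.
namespace GradedSuperSpace

variable {V W : GradedSuperSpace}

/-- The span of the products of at least `N` homogeneous generators of total bidegree `i`. -/
def lengthFiltration (V : GradedSuperSpace) (N : ℕ) (i : ℕ × ZMod 2) : Submodule ℝ V.Sym :=
  Submodule.span ℝ {a | ∃ l, N ≤ l.length ∧ V.monomialDegree l = i ∧ V.monomial l = a}

theorem monomial_mem_lengthFiltration {N : ℕ}
    {l : List (Σ i : ℕ × ZMod 2, Module.Dual ℝ (V.carrier i.1 i.2))} (h : N ≤ l.length) :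
    V.monomial l ∈ V.lengthFiltration N (V.monomialDegree l) :=
  Submodule.subset_span ⟨l, h, rfl, rfl⟩

theorem gen_mem_lengthFiltration (i : ℕ × ZMod 2) (α : Module.Dual ℝ (V.carrier i.1 i.2)) :
    V.gen i α ∈ V.lengthFiltration 1 (shift i) :=
  Submodule.subset_span ⟨[⟨i, α⟩], by simp, by simp [monomialDegree], by simp [monomial]⟩

theorem length_le_monomialDegree
    (l : List (Σ i : ℕ × ZMod 2, Module.Dual ℝ (V.carrier i.1 i.2))) :
    l.length ≤ (V.monomialDegree l).1 := by
  induction l with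
  | nil => simp
  | cons x l ih =>
    rw [monomialDegree_cons, Prod.fst_add, List.length_cons, shift]
    omega

/-- Every generator has degree at least one, so word length is bounded by degree. The filtration is
therefore finite in each degree, and successive approximations along it terminate. -/
theorem lengthFiltration_eq_bot {N : ℕ} {i : ℕ × ZMod 2} (h : i.1 < N) :
    V.lengthFiltration N i = ⊥ := by
  rw [lengthFiltration, Submodule.span_eq_bot]
  rintro _ ⟨l, hl, rfl, rfl⟩
  have := length_le_monomialDegree l
  omega

theorem lengthFiltration_le_homog (N : ℕ) (i : ℕ × ZMod 2) :
    V.lengthFiltration N i ≤ V.homog i :=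
  Submodule.span_mono fun _ ⟨l, _, h⟩ => ⟨l, h⟩

theorem lengthFiltration_anti {M N : ℕ} (h : M ≤ N) (i : ℕ × ZMod 2) :
    V.lengthFiltration N i ≤ V.lengthFiltration M i :=
  Submodule.span_mono fun _ ⟨l, hl, h'⟩ => ⟨l, h.trans hl, h'⟩

theorem homog_le_lengthFiltration_one (k : ℕ) (s : ZMod 2) :
    V.homog (k + 1, s) ≤ V.lengthFiltration 1 (k + 1, s) := by
  refine Submodule.span_mono ?_
  rintro _ ⟨l, hl, rfl⟩
  refine ⟨l, ?_, hl, rfl⟩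
  rcases l with - | ⟨x, l⟩
  · simpa [monomialDegree_nil] using congrArg Prod.fst hl
  · simp

theorem mul_mem_lengthFiltration {M N : ℕ} {i j : ℕ × ZMod 2} {a b : V.Sym}
    (ha : a ∈ V.lengthFiltration M i) (hb : b ∈ V.lengthFiltration N j) :
    a * b ∈ V.lengthFiltration (M + N) (i + j) := by
  have h : V.lengthFiltration M i * V.lengthFiltration N j ≤ V.lengthFiltration (M + N) (i + j) := by
    rw [lengthFiltration, lengthFiltration, Submodule.span_mul_span, Submodule.span_le]
    rintro _ ⟨_, ⟨l, hl, rfl, rfl⟩, _, ⟨m, hm, rfl, rfl⟩, rfl⟩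
    exact Submodule.subset_span ⟨l ++ m, by simp; omega, by simp [monomialDegree],
      by simp [monomial]⟩
  exact h (Submodule.mul_mem_mul ha hb)

theorem linearPart_gen_mul_gen_mul {i j : ℕ × ZMod 2} (α : Module.Dual ℝ (V.carrier i.1 i.2))
    (β : Module.Dual ℝ (V.carrier j.1 j.2)) (b : V.Sym) :
    V.linearPart (V.gen i α * (V.gen j β * b)) = 0 := by
  simp [linearPart, gen, lift_gens]

theorem linearPart_of_mem_lengthFiltration {i : ℕ × ZMod 2} {a : V.Sym}
    (ha : a ∈ V.lengthFiltration 2 i) : V.linearPart a = 0 := by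
  induction ha using Submodule.span_induction with
  | zero => simp
  | add x y _ _ hx hy => rw [map_add, hx, hy, add_zero]
  | smul r x _ hx => rw [map_smul, hx, smul_zero]
  | mem x hx =>
    obtain ⟨l, hl, -, rfl⟩ := hx
    match l, hl with
    | x :: y :: l, _ => rw [monomial_cons, monomial_cons, linearPart_gen_mul_gen_mul]

/-- The decomposition of a homogeneous element of positive degree into a generator and a sum of
products of at least two generators. -/
theorem exists_linearPart_eq {k : ℕ} {s : ZMod 2} {a : V.Sym} (ha : a ∈ V.homog (k + 1, s)) :
    (∃ α, V.linearPart a = V.inDual (k, s) α) ∧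
      a - V.gens (V.linearPart a) ∈ V.lengthFiltration 2 (k + 1, s) := by
  induction ha using Submodule.span_induction with
  | zero => exact ⟨⟨0, by simp⟩, by simp⟩
  | add x y _ _ hx hy =>
    obtain ⟨⟨α, hα⟩, hx⟩ := hx
    obtain ⟨⟨β, hβ⟩, hy⟩ := hy
    refine ⟨⟨α + β, by rw [map_add, map_add, hα, hβ]⟩, ?_⟩
    rw [map_add, map_add, add_sub_add_comm]
    exact add_mem hx hy
  | smul r x _ hx =>
    obtain ⟨⟨α, hα⟩, hx⟩ := hx
    refine ⟨⟨r • α, by rw [map_smul, map_smul, hα]⟩, ?_⟩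
    rw [map_smul, map_smul, ← smul_sub]
    exact Submodule.smul_mem _ _ hx
  | mem x hx =>
    obtain ⟨l, hl, rfl⟩ := hx
    match l, hl with
    | [], hl => simpa [monomialDegree] using congrArg Prod.fst hl
    | [⟨(a, t), α⟩], hl =>
      have h1 : V.monomial [⟨(a, t), α⟩] = V.gens (V.inDual (a, t) α) := by simp [monomial, gen]
      have hl' : a = k ∧ t = s := by simpa [monomialDegree, shift] using hl
      obtain ⟨rfl, rfl⟩ := hl'
      rw [h1, linearPart_gens]
      exact ⟨⟨α, rfl⟩, by simp⟩
    | x :: y :: l, hl =>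
      have h2 : V.monomial (x :: y :: l) ∈ V.lengthFiltration 2 (k + 1, s) := by
        rw [← hl]; exact monomial_mem_lengthFiltration (by simp)
      rw [linearPart_of_mem_lengthFiltration h2]
      exact ⟨⟨0, by simp⟩, by simpa using h2⟩

theorem IsOddDerivation.map_lengthFiltration {δ : V.Sym →ₗ[ℝ] V.Sym} (hδ : IsOddDerivation δ)
    (h : ∀ (i : ℕ × ZMod 2) α, δ (V.gen i α) ∈ V.homog (i.1 + 1 + 1, i.2)) {N k : ℕ} {s : ZMod 2}
    {a : V.Sym} (ha : a ∈ V.lengthFiltration N (k, s)) :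
    δ a ∈ V.lengthFiltration N (k + 1, s) := by
  have hl : ∀ l, δ (V.monomial l) ∈
      V.lengthFiltration l.length (V.monomialDegree l + (1, 0)) := by
    intro l
    induction l with
    | nil => rw [monomial_nil, hδ.map_one]; exact zero_mem _
    | cons x l ih =>
      rw [monomial_cons, monomialDegree_cons, hδ.map_gen_mul, List.length_cons, add_comm l.length]
      refine add_mem ?_ (Submodule.smul_mem _ _ ?_)
      · have := mul_mem_lengthFiltration (homog_le_lengthFiltration_one _ _ (h x.1 x.2))
          (monomial_mem_lengthFiltration (le_refl l.length))
        convert this using 2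
        ext <;> simp [shift]; ring
      · have := mul_mem_lengthFiltration (gen_mem_lengthFiltration x.1 x.2) ih
        rwa [← add_assoc (shift _)] at this
  induction ha using Submodule.span_induction with
  | zero => simp
  | add x y _ _ hx hy => rw [map_add]; exact add_mem hx hy
  | smul r x _ hx => rw [map_smul]; exact Submodule.smul_mem _ _ hx
  | mem x hx =>
    obtain ⟨l, hN, hl', rfl⟩ := hx
    have := hl l
    rw [hl', Prod.mk_add_mk, add_zero] at this
    exact lengthFiltration_anti hN _ this

theorem Differential.map_lengthFiltration (D : V.Differential) {N k : ℕ} {s : ZMod 2}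
    {a : V.Sym} (ha : a ∈ V.lengthFiltration N (k, s)) :
    D.d a ∈ V.lengthFiltration N (k + 1, s) :=
  D.isOddDerivation.map_lengthFiltration
    (fun i α => D.map_homog _ _ _ (V.gen_mem_homog i α)) ha

theorem map_lengthFiltration (f : W.Sym →ₐ[ℝ] V.Sym)
    (hf : ∀ i α, f (W.gen i α) ∈ V.homog (shift i)) {N : ℕ} {i : ℕ × ZMod 2} {a : W.Sym}
    (ha : a ∈ W.lengthFiltration N i) : f a ∈ V.lengthFiltration N i := by
  have h : ∀ l, f (W.monomial l) ∈ V.lengthFiltration l.length (W.monomialDegree l) := by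
    intro l
    induction l with
    | nil => rw [monomial_nil, map_one]; exact Submodule.subset_span ⟨[], le_rfl, rfl, rfl⟩
    | cons x l ih =>
      rw [monomial_cons, monomialDegree_cons, map_mul, List.length_cons, add_comm l.length]
      exact mul_mem_lengthFiltration (homog_le_lengthFiltration_one _ _ (hf _ _)) ih
  induction ha using Submodule.span_induction with
  | zero => simp
  | add x y _ _ hx hy => rw [map_add]; exact add_mem hx hy
  | smul r x _ hx => rw [map_smul]; exact Submodule.smul_mem _ _ hx
  | mem x hx =>
    obtain ⟨l, hN, rfl, rfl⟩ := hx
    exact lengthFiltration_anti hN _ (h l)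

/-- The linear component of an algebra map. -/
def linearComponent (f : W.Sym →ₐ[ℝ] V.Sym) : W.ShiftedDual →ₗ[ℝ] V.ShiftedDual :=
  V.linearPart ∘ₗ f.toLinearMap ∘ₗ W.gens

theorem linearComponent_apply (f : W.Sym →ₐ[ℝ] V.Sym) (v : W.ShiftedDual) :
    linearComponent f v = V.linearPart (f (W.gens v)) := rfl

theorem linearComponent_inDual (f : W.Sym →ₐ[ℝ] V.Sym)
    (hf : ∀ i α, f (W.gen i α) ∈ V.homog (shift i)) (i : ℕ × ZMod 2)
    (α : Module.Dual ℝ (W.carrier i.1 i.2)) :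
    (∃ α', linearComponent f (W.inDual i α) = V.inDual i α') ∧
      f (W.gen i α) - V.gens (linearComponent f (W.inDual i α)) ∈
        V.lengthFiltration 2 (shift i) :=
  exists_linearPart_eq (hf i α)

/-- A map of bidegree zero does not shorten words, so the decomposable part of `a` contributes
nothing to the linear part of `f a`. This makes linear components functorial. -/
theorem linearPart_map (f : W.Sym →ₐ[ℝ] V.Sym)
    (hf : ∀ i α, f (W.gen i α) ∈ V.homog (shift i)) {k : ℕ} {s : ZMod 2} {a : W.Sym}
    (ha : a ∈ W.homog (k + 1, s)) :
    V.linearPart (f a) = linearComponent f (W.linearPart a) := by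
  have h := linearPart_of_mem_lengthFiltration
    (map_lengthFiltration f hf (exists_linearPart_eq ha).2)
  rwa [map_sub, map_sub, sub_eq_zero] at h

theorem Differential.linearPart_d (D : V.Differential) {k : ℕ} {s : ZMod 2} {a : V.Sym}
    (ha : a ∈ V.homog (k + 1, s)) :
    V.linearPart (D.d a) = V.linearPart (D.d (V.gens (V.linearPart a))) := by
  have h := linearPart_of_mem_lengthFiltration
    (D.map_lengthFiltration (exists_linearPart_eq ha).2)
  rwa [map_sub, map_sub, sub_eq_zero] at h

theorem linearComponent_comp {U : GradedSuperSpace} (f : W.Sym →ₐ[ℝ] V.Sym)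
    (hf : ∀ i α, f (W.gen i α) ∈ V.homog (shift i)) (f' : U.Sym →ₐ[ℝ] W.Sym)
    (hf' : ∀ i α, f' (U.gen i α) ∈ W.homog (shift i)) (v : U.ShiftedDual) :
    linearComponent (f.comp f') v = linearComponent f (linearComponent f' v) := by
  refine LinearMap.congr_fun (g := linearComponent f ∘ₗ linearComponent f')
    (shiftedDual_hom_ext fun i α => ?_) v
  exact linearPart_map f hf (hf' i α)

theorem linearComponent_id (v : V.ShiftedDual) : linearComponent (AlgHom.id ℝ V.Sym) v = v :=
  V.linearPart_gens v

/-- A graded map between spaces of generators commutes with the projections to components. -/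
theorem map_inDual_component (T : W.ShiftedDual →ₗ[ℝ] V.ShiftedDual)
    (σ : ℕ × ZMod 2 → ℕ × ZMod 2) (hσ : Function.Injective σ)
    (hT : ∀ i α, ∃ α', T (W.inDual i α) = V.inDual (σ i) α') (i : ℕ × ZMod 2)
    (v : W.ShiftedDual) : T (W.inDual i (v i)) = V.inDual (σ i) (T v (σ i)) := by
  refine LinearMap.congr_fun (f := T ∘ₗ W.inDual i ∘ₗ DirectSum.component ℝ _ _ i)
    (g := V.inDual (σ i) ∘ₗ DirectSum.component ℝ _ _ (σ i) ∘ₗ T)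
    (shiftedDual_hom_ext fun j β => ?_) v
  obtain ⟨β', hβ⟩ := hT j β
  simp only [LinearMap.comp_apply, hβ]
  by_cases hij : j = i
  · subst hij
    rw [inDual, DirectSum.component.lof_self, inDual, DirectSum.component.lof_self]
    exact hβ
  · rw [inDual, inDual, DirectSum.component.of, dif_neg hij, DirectSum.component.of,
      dif_neg fun h => hij (hσ h), map_zero, map_zero, map_zero]

theorem monomial_mem_map_homog (f : W.Sym →ₐ[ℝ] V.Sym)
    (l : List (Σ i : ℕ × ZMod 2, Module.Dual ℝ (V.carrier i.1 i.2)))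
    (h : ∀ x ∈ l, ∃ b ∈ W.homog (shift x.1), f b = V.gen x.1 x.2) :
    ∃ b ∈ W.homog (V.monomialDegree l), f b = V.monomial l := by
  induction l with
  | nil => exact ⟨1, W.one_mem_homog, map_one f⟩
  | cons x l ih =>
    obtain ⟨b, hb, hb'⟩ := h x (by simp)
    obtain ⟨c, hc, hc'⟩ := ih fun y hy => h y (List.mem_cons_of_mem _ hy)
    rw [monomialDegree_cons]
    exact ⟨b * c, W.mul_mem_homog hb hc, by rw [map_mul, hb', hc', monomial_cons]⟩

theorem le_monomialDegree_of_mem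
    {l : List (Σ i : ℕ × ZMod 2, Module.Dual ℝ (V.carrier i.1 i.2))} {x} (hx : x ∈ l) :
    x.1.1 + l.length ≤ (V.monomialDegree l).1 := by
  induction l with
  | nil => simp at hx
  | cons y l ih =>
    rw [monomialDegree_cons, Prod.fst_add, List.length_cons, shift]
    rcases List.mem_cons.1 hx with rfl | h
    · have := length_le_monomialDegree l
      omega
    · have := ih h
      omega

/-- An algebra map of bidegree zero whose linear component is surjective is surjective on
homogeneous generators. -/
theorem exists_map_eq_gen (f : W.Sym →ₐ[ℝ] V.Sym)
    (hf : ∀ i α, f (W.gen i α) ∈ V.homog (shift i))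
    (hs : Function.Surjective (linearComponent f)) (k : ℕ) :
    ∀ (s : ZMod 2) (α : Module.Dual ℝ (V.carrier k s)),
      ∃ b ∈ W.homog (k + 1, s), f b = V.gen (k, s) α := by
  induction k using Nat.strong_induction_on with
  | _ k ih =>
    intro s α
    obtain ⟨v, hv⟩ := hs (V.inDual (k, s) α)
    have hc := map_inDual_component (linearComponent f) id Function.injective_id
      (fun i α => (linearComponent_inDual f hf i α).1) (k, s) v
    have hr := (linearComponent_inDual f hf (k, s) (v (k, s))).2
    rw [hc, hv] at hr
    -- A product of at least two generators in degree `k + 1` has all its factors in components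
    -- below `k`, where the induction hypothesis supplies preimages. This covers the nonlinear
    -- remainder `hr`, whose preimage is subtracted below.
    have hdec : ∀ a ∈ V.lengthFiltration 2 (k + 1, s), ∃ b ∈ W.homog (k + 1, s), f b = a := by
      intro a ha
      suffices h : V.lengthFiltration 2 (k + 1, s) ≤
          (W.homog (k + 1, s)).map f.toLinearMap from h ha
      refine Submodule.span_le.2 ?_
      rintro _ ⟨l, hl, hl', rfl⟩
      rw [← hl']
      refine monomial_mem_map_homog f l fun x hx => ih x.1.1 ?_ x.1.2 x.2
      have := le_monomialDegree_of_mem hx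
      rw [hl'] at this
      omega
    obtain ⟨b, hb, hb'⟩ := hdec _ hr
    refine ⟨W.gen (k, s) (v (k, s)) - b, Submodule.sub_mem _ (W.gen_mem_homog (k, s) (v (k, s))) hb, ?_⟩
    rw [map_sub, hb', sub_sub_cancel]
    simp [gen]

theorem surjective_of_linearComponent (f : W.Sym →ₐ[ℝ] V.Sym)
    (hf : ∀ i α, f (W.gen i α) ∈ V.homog (shift i))
    (hs : Function.Surjective (linearComponent f)) : Function.Surjective f := by
  intro a
  have h : Submodule.span ℝ (Set.range V.monomial) ≤ LinearMap.range f.toLinearMap := by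
    refine Submodule.span_le.2 ?_
    rintro _ ⟨l, rfl⟩
    obtain ⟨b, -, hb⟩ := monomial_mem_map_homog f l
      fun x _ => exists_map_eq_gen f hf hs x.1.1 x.1.2 x.2
    exact ⟨b, hb⟩
  rw [span_monomials] at h
  exact h trivial

/-- An algebra map of bidegree zero whose linear component is bijective has an inverse of
bidegree zero. -/
theorem exists_inverse_of_linearComponent (f : W.Sym →ₐ[ℝ] V.Sym)
    (hf : ∀ i α, f (W.gen i α) ∈ V.homog (shift i))
    (hb : Function.Bijective (linearComponent f)) :
    ∃ s : V.Sym →ₐ[ℝ] W.Sym, (∀ i α, s (V.gen i α) ∈ W.homog (shift i)) ∧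
      (∀ a, f (s a) = a) ∧ ∀ b, s (f b) = b := by
  have hsec : ∀ i : ℕ × ZMod 2, ∃ σ : Module.Dual ℝ (V.carrier i.1 i.2) →ₗ[ℝ] W.Sym,
      ∀ α, σ α ∈ W.homog (shift i) ∧ f (σ α) = V.gen i α := by
    intro i
    -- Pairs of a homogeneous element and a form whose generator it maps to. A linear right inverse
    -- of the projection to the form makes the choice of preimages linear in `α`.
    let P : Submodule ℝ (W.Sym × Module.Dual ℝ (V.carrier i.1 i.2)) :=
      (W.homog (shift i)).comap (LinearMap.fst ℝ _ _) ⊓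
        LinearMap.eqLocus (f.toLinearMap ∘ₗ LinearMap.fst ℝ _ _)
          (V.gens ∘ₗ V.inDual i ∘ₗ LinearMap.snd ℝ _ _)
    let F : P →ₗ[ℝ] Module.Dual ℝ (V.carrier i.1 i.2) := LinearMap.snd ℝ _ _ ∘ₗ P.subtype
    have hF : LinearMap.range F = ⊤ := by
      rw [LinearMap.range_eq_top]
      intro α
      obtain ⟨b, hb, hb'⟩ := exists_map_eq_gen f hf hb.2 i.1 i.2 α
      exact ⟨⟨(b, α), hb, hb'⟩, rfl⟩
    obtain ⟨T, hT⟩ := F.exists_rightInverse_of_surjective hF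
    refine ⟨LinearMap.fst ℝ _ _ ∘ₗ P.subtype ∘ₗ T, fun α => ⟨(T α).2.1, ?_⟩⟩
    have h1 : f (T α).1.1 = V.gens (V.inDual i (T α).1.2) := (T α).2.2
    have h2 : (T α).1.2 = α := LinearMap.congr_fun hT α
    rw [h2] at h1
    exact h1
  choose σ hσ using hsec
  let S : V.ShiftedDual →ₗ[ℝ] W.Sym := DirectSum.toModule ℝ _ _ σ
  have hS : ∀ i α, S (V.inDual i α) = σ i α := fun i α => DirectSum.toModule_lof _ _ _
  let s := liftGraded S fun i α => by rw [hS]; exact (hσ i α).1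
  have hsgen : ∀ i α, s (V.gen i α) = σ i α := fun i α => by
    rw [gen, liftGraded_gens, hS]
  have hs : ∀ i α, s (V.gen i α) ∈ W.homog (shift i) := fun i α => by
    rw [hsgen]; exact (hσ i α).1
  have hfs : f.comp s = AlgHom.id ℝ V.Sym :=
    hom_ext_gen fun i α => by rw [AlgHom.comp_apply, hsgen, (hσ i α).2, AlgHom.id_apply]
  have hfs' : ∀ a, f (s a) = a := fun a => AlgHom.congr_fun hfs a
  -- The linear component of `s` is right inverse to that of `f`, which is injective, so it is its
  -- inverse. Hence `s` is itself surjective, and the one-sided inverse is two-sided.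
  have hlin : Function.Surjective (linearComponent s) := fun w => by
    refine ⟨linearComponent f w, hb.1 ?_⟩
    rw [← linearComponent_comp f hf s hs, hfs, linearComponent_id]
  refine ⟨s, hs, hfs', fun b => ?_⟩
  obtain ⟨a, rfl⟩ := surjective_of_linearComponent s hs hlin b
  rw [hfs']

end GradedSuperSpace

/-! ### Linear components of homomorphisms and the unary bracket. -/

namespace SuperLInfAlgebra

variable {g h k : SuperLInfAlgebra}

theorem gen_map_mem_homog (f : g ⟶ h) (i : ℕ × ZMod 2)
    (α : Module.Dual ℝ (h.space.carrier i.1 i.2)) :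
    Hom.toAlgHom f (h.space.gen i α) ∈ g.space.homog (shift i) :=
  Hom.map_homog f _ _ (h.space.gen_mem_homog i α)

theorem linear_apply (f : g ⟶ h) (v : h.space.ShiftedDual) :
    Hom.linear f v = g.space.linearPart (Hom.toAlgHom f (h.space.gens v)) := rfl

theorem linear_comp (f : g ⟶ h) (f' : h ⟶ k) (v : k.space.ShiftedDual) :
    Hom.linear (f ≫ f') v = Hom.linear f (Hom.linear f' v) :=
  linearComponent_comp _ (gen_map_mem_homog f) _ (gen_map_mem_homog f') v

theorem linear_id (v : g.space.ShiftedDual) : Hom.linear (𝟙 g) v = v :=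
  linearComponent_id v

theorem unary_apply (v : g.space.ShiftedDual) :
    g.unary v = g.space.linearPart (g.d (g.space.gens v)) := rfl

theorem unary_inDual (g : SuperLInfAlgebra) (i : ℕ × ZMod 2)
    (α : Module.Dual ℝ (g.space.carrier i.1 i.2)) :
    (∃ α', g.unary (g.space.inDual i α) = g.space.inDual (i.1 + 1, i.2) α') ∧
      g.d (g.space.gen i α) - g.space.gens (g.unary (g.space.inDual i α)) ∈
        g.space.lengthFiltration 2 (i.1 + 1 + 1, i.2) :=
  exists_linearPart_eq (g.diff.map_homog _ _ _ (g.space.gen_mem_homog i α))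

/-- The linear part of `d (d x) = 0`: since `d` never shortens words, the linear part of `d a`
depends only on that of `a`. -/
theorem unary_unary (v : g.space.ShiftedDual) : g.unary (g.unary v) = 0 := by
  refine LinearMap.congr_fun (f := g.unary ∘ₗ g.unary) (g := 0)
    (shiftedDual_hom_ext fun i α => ?_) v
  have h := g.diff.linearPart_d (g.diff.map_homog _ _ _ (g.space.gen_mem_homog i α))
  rw [g.diff.sq_zero, map_zero] at h
  exact h.symm

theorem linear_unary (f : g ⟶ h) (v : h.space.ShiftedDual) :
    Hom.linear f (h.unary v) = g.unary (Hom.linear f v) := by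
  refine LinearMap.congr_fun (f := Hom.linear f ∘ₗ h.unary) (g := g.unary ∘ₗ Hom.linear f)
    (shiftedDual_hom_ext fun i α => ?_) v
  have h1 := linearPart_map _ (gen_map_mem_homog f)
    (h.diff.map_homog _ _ _ (h.space.gen_mem_homog i α))
  have h2 := g.diff.linearPart_d (gen_map_mem_homog f i α)
  exact h1.symm.trans ((congrArg _ (Hom.map_d f _)).trans h2)

/-- An inverse function theorem: the algebra map is inverted by `exists_inverse_of_linearComponent`,
and the inverse of a bijection that commutes with the differentials commutes with them too. -/
theorem isIso_of_linear_bijective (f : g ⟶ h) (hf : Function.Bijective (Hom.linear f)) :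
    IsIso f := by
  obtain ⟨s, hs, hfs, hsf⟩ := exists_inverse_of_linearComponent _ (gen_map_mem_homog f) hf
  let F : h ⟶ g := Hom.mk (g := h) (h := g) s (fun _ _ ha => map_homog_of_gen s hs ha) fun a => by
    have h1 := Hom.map_d f (s a)
    rw [hfs] at h1
    rw [← h1, hsf]
  exact ⟨F, Hom.ext (AlgHom.ext hfs), Hom.ext (AlgHom.ext hsf)⟩

theorem isWeakEquivalence_of_isIso (f : g ⟶ h) [IsIso f] : IsWeakEquivalence f := by
  have h1 : ∀ v, Hom.linear (inv f) (Hom.linear f v) = v := fun v => by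
    rw [← linear_comp, IsIso.inv_hom_id, linear_id]
  have h2 : ∀ v, Hom.linear f (Hom.linear (inv f) v) = v := fun v => by
    rw [← linear_comp, IsIso.hom_inv_id, linear_id]
  refine ⟨fun v _ ⟨u, hu⟩ => ⟨Hom.linear (inv f) u, ?_⟩, fun w hw =>
    ⟨Hom.linear (inv f) w, ?_, 0, ?_⟩⟩
  · rw [← linear_unary, ← hu, h1]
  · rw [← linear_unary, hw, map_zero]
  · rw [h2, map_zero, add_zero]

end SuperLInfAlgebra
-- Transposes, direct sums and the one-generator algebra.
namespace GradedSuperSpace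

variable {U V W : GradedSuperSpace}

/-- The transpose on spaces of generators of a family of linear maps. -/
def dualMap (f : ∀ k s, V.carrier k s →ₗ[ℝ] W.carrier k s) : W.ShiftedDual →ₗ[ℝ] V.ShiftedDual :=
  DirectSum.toModule ℝ _ _ fun i => V.inDual i ∘ₗ Module.Dual.transpose (f i.1 i.2)

theorem dualMap_inDual (f : ∀ k s, V.carrier k s →ₗ[ℝ] W.carrier k s) (i : ℕ × ZMod 2)
    (α : Module.Dual ℝ (W.carrier i.1 i.2)) :
    dualMap f (W.inDual i α) = V.inDual i (α ∘ₗ f i.1 i.2) := by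
  rw [dualMap, inDual, DirectSum.toModule_lof]
  rfl

theorem symMap_gens (f : ∀ k s, V.carrier k s →ₗ[ℝ] W.carrier k s) (w : W.ShiftedDual) :
    symMap f (W.gens w) = V.gens (dualMap f w) := by
  refine LinearMap.congr_fun (f := (symMap f).toLinearMap ∘ₗ W.gens) (g := V.gens ∘ₗ dualMap f)
    (shiftedDual_hom_ext fun i α => ?_) w
  simp only [LinearMap.comp_apply, dualMap_inDual]
  exact symMap_gen f i α

theorem symMap_gen_mem_homog (f : ∀ k s, V.carrier k s →ₗ[ℝ] W.carrier k s) (i : ℕ × ZMod 2)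
    (α : Module.Dual ℝ (W.carrier i.1 i.2)) : symMap f (W.gen i α) ∈ V.homog (shift i) := by
  rw [symMap_gen]
  exact V.gen_mem_homog _ _

theorem symMap_mem_homog (f : ∀ k s, V.carrier k s →ₗ[ℝ] W.carrier k s) {i : ℕ × ZMod 2}
    {a : W.Sym} (ha : a ∈ W.homog i) : symMap f a ∈ V.homog i :=
  map_homog_of_gen _ (symMap_gen_mem_homog f) ha

theorem linearComponent_symMap (f : ∀ k s, V.carrier k s →ₗ[ℝ] W.carrier k s)
    (w : W.ShiftedDual) : linearComponent (symMap f) w = dualMap f w := by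
  rw [linearComponent_apply, symMap_gens, linearPart_gens]

/-! ### Direct sums -/

/-- The first projection of a direct sum. -/
def sumFst (V W : GradedSuperSpace) (k : ℕ) (s : ZMod 2) :
    (V.sum W).carrier k s →ₗ[ℝ] V.carrier k s :=
  LinearMap.fst ℝ (V.carrier k s) (W.carrier k s)

/-- The second projection of a direct sum. -/
def sumSnd (V W : GradedSuperSpace) (k : ℕ) (s : ZMod 2) :
    (V.sum W).carrier k s →ₗ[ℝ] W.carrier k s :=
  LinearMap.snd ℝ (V.carrier k s) (W.carrier k s)

/-- The first injection of a direct sum. -/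
def sumInl (V W : GradedSuperSpace) (k : ℕ) (s : ZMod 2) :
    V.carrier k s →ₗ[ℝ] (V.sum W).carrier k s :=
  LinearMap.inl ℝ (V.carrier k s) (W.carrier k s)

/-- The second injection of a direct sum. -/
def sumInr (V W : GradedSuperSpace) (k : ℕ) (s : ZMod 2) :
    W.carrier k s →ₗ[ℝ] (V.sum W).carrier k s :=
  LinearMap.inr ℝ (V.carrier k s) (W.carrier k s)

theorem dualMap_sum (v : (V.sum W).ShiftedDual) :
    dualMap (sumFst V W) (dualMap (sumInl V W) v) +
      dualMap (sumSnd V W) (dualMap (sumInr V W) v) = v := by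
  refine LinearMap.congr_fun (f := dualMap (sumFst V W) ∘ₗ dualMap (sumInl V W) +
      dualMap (sumSnd V W) ∘ₗ dualMap (sumInr V W)) (g := LinearMap.id)
    (shiftedDual_hom_ext fun i α => ?_) v
  simp only [LinearMap.add_apply, LinearMap.comp_apply, dualMap_inDual, LinearMap.id_apply,
    ← map_add]
  congr 1
  refine LinearMap.ext fun x => ?_
  exact (map_add α _ _).symm.trans (congrArg α (Prod.ext (add_zero _) (zero_add _)))

theorem dualMap_sumInl_sumFst (v : V.ShiftedDual) :
    dualMap (sumInl V W) (dualMap (sumFst V W) v) = v := by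
  refine LinearMap.congr_fun (f := dualMap (sumInl V W) ∘ₗ dualMap (sumFst V W))
    (g := LinearMap.id) (shiftedDual_hom_ext fun i α => ?_) v
  simp only [LinearMap.comp_apply, dualMap_inDual, LinearMap.id_apply]
  rfl

theorem dualMap_sumInr_sumSnd (w : W.ShiftedDual) :
    dualMap (sumInr V W) (dualMap (sumSnd V W) w) = w := by
  refine LinearMap.congr_fun (f := dualMap (sumInr V W) ∘ₗ dualMap (sumSnd V W))
    (g := LinearMap.id) (shiftedDual_hom_ext fun i α => ?_) w
  simp only [LinearMap.comp_apply, dualMap_inDual, LinearMap.id_apply]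
  rfl

theorem dualMap_sumInl_sumSnd (w : W.ShiftedDual) :
    dualMap (sumInl V W) (dualMap (sumSnd V W) w) = 0 := by
  refine LinearMap.congr_fun (f := dualMap (sumInl V W) ∘ₗ dualMap (sumSnd V W))
    (g := 0) (shiftedDual_hom_ext fun i α => ?_) w
  simp only [LinearMap.comp_apply, dualMap_inDual, LinearMap.zero_apply]
  refine (congrArg (V.inDual i) (LinearMap.ext fun x => ?_)).trans (map_zero _)
  exact map_zero α

theorem dualMap_sumInr_sumFst (v : V.ShiftedDual) :
    dualMap (sumInr V W) (dualMap (sumFst V W) v) = 0 := by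
  refine LinearMap.congr_fun (f := dualMap (sumInr V W) ∘ₗ dualMap (sumFst V W))
    (g := 0) (shiftedDual_hom_ext fun i α => ?_) v
  simp only [LinearMap.comp_apply, dualMap_inDual, LinearMap.zero_apply]
  refine (congrArg (W.inDual i) (LinearMap.ext fun x => ?_)).trans (map_zero _)
  exact map_zero α

/-- The inclusion of the first tensor factor `Sym V` into `Sym (V ⊕ W)`. -/
def symInl (V W : GradedSuperSpace) : V.Sym →ₐ[ℝ] (V.sum W).Sym := symMap (sumFst V W)

/-- The inclusion of the second tensor factor `Sym W` into `Sym (V ⊕ W)`. -/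
def symInr (V W : GradedSuperSpace) : W.Sym →ₐ[ℝ] (V.sum W).Sym := symMap (sumSnd V W)

theorem gens_sum (v : (V.sum W).ShiftedDual) : (V.sum W).gens v =
    symInl V W (V.gens (dualMap (sumInl V W) v)) +
      symInr V W (W.gens (dualMap (sumInr V W) v)) := by
  rw [symInl, symInr, symMap_gens, symMap_gens, ← map_add, dualMap_sum]

theorem gen_sum (i : ℕ × ZMod 2) (α : Module.Dual ℝ ((V.sum W).carrier i.1 i.2)) :
    (V.sum W).gen i α = symInl V W (V.gen i (α ∘ₗ sumInl V W i.1 i.2)) +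
      symInr V W (W.gen i (α ∘ₗ sumInr V W i.1 i.2)) := by
  rw [gen, gens_sum, dualMap_inDual, dualMap_inDual]
  rfl

theorem sum_hom_ext {A : Type} [Ring A] [Algebra ℝ A] {f f' : (V.sum W).Sym →ₐ[ℝ] A}
    (hl : ∀ i α, f (symInl V W (V.gen i α)) = f' (symInl V W (V.gen i α)))
    (hr : ∀ i α, f (symInr V W (W.gen i α)) = f' (symInr V W (W.gen i α))) : f = f' :=
  hom_ext_gen fun i α => by rw [gen_sum, map_add, map_add, hl, hr]

theorem IsOddDerivation.ext_sum {δ δ' : (V.sum W).Sym →ₗ[ℝ] (V.sum W).Sym}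
    (hδ : IsOddDerivation δ) (hδ' : IsOddDerivation δ')
    (hl : ∀ i α, δ (symInl V W (V.gen i α)) = δ' (symInl V W (V.gen i α)))
    (hr : ∀ i α, δ (symInr V W (W.gen i α)) = δ' (symInr V W (W.gen i α))) : δ = δ' :=
  hδ.ext hδ' fun i α => by rw [gen_sum, map_add, map_add, hl, hr]

/-- The algebra map out of `Sym (V ⊕ W)` with given restrictions to `Sym V` and `Sym W`. -/
def symDesc (f : V.Sym →ₐ[ℝ] U.Sym) (hf : ∀ i α, f (V.gen i α) ∈ U.homog (shift i))
    (f' : W.Sym →ₐ[ℝ] U.Sym) (hf' : ∀ i α, f' (W.gen i α) ∈ U.homog (shift i)) :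
    (V.sum W).Sym →ₐ[ℝ] U.Sym :=
  liftGraded (f.toLinearMap ∘ₗ V.gens ∘ₗ dualMap (sumInl V W) +
    f'.toLinearMap ∘ₗ W.gens ∘ₗ dualMap (sumInr V W)) fun i α => by
      simp only [LinearMap.add_apply, LinearMap.comp_apply, dualMap_inDual]
      exact Submodule.add_mem _ (hf i _) (hf' i _)

section

variable (f : V.Sym →ₐ[ℝ] U.Sym) (hf : ∀ i α, f (V.gen i α) ∈ U.homog (shift i))
  (f' : W.Sym →ₐ[ℝ] U.Sym) (hf' : ∀ i α, f' (W.gen i α) ∈ U.homog (shift i))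

theorem symDesc_gens (v : (V.sum W).ShiftedDual) : symDesc f hf f' hf' ((V.sum W).gens v) =
    f (V.gens (dualMap (sumInl V W) v)) + f' (W.gens (dualMap (sumInr V W) v)) := by
  rw [symDesc, liftGraded_gens]
  rfl

theorem symDesc_symInl (a : V.Sym) : symDesc f hf f' hf' (symInl V W a) = f a := by
  refine AlgHom.congr_fun (φ₁ := (symDesc f hf f' hf').comp (symInl V W))
    (V.hom_ext fun v => ?_) a
  rw [AlgHom.comp_apply, symInl, symMap_gens, symDesc_gens, dualMap_sumInl_sumFst,
    dualMap_sumInr_sumFst, map_zero, map_zero, add_zero]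

theorem symDesc_symInr (a : W.Sym) : symDesc f hf f' hf' (symInr V W a) = f' a := by
  refine AlgHom.congr_fun (φ₁ := (symDesc f hf f' hf').comp (symInr V W))
    (W.hom_ext fun v => ?_) a
  rw [AlgHom.comp_apply, symInr, symMap_gens, symDesc_gens, dualMap_sumInr_sumSnd,
    dualMap_sumInl_sumSnd, map_zero, map_zero, zero_add]

theorem symDesc_gen_mem_homog (i : ℕ × ZMod 2)
    (α : Module.Dual ℝ ((V.sum W).carrier i.1 i.2)) :
    symDesc f hf f' hf' ((V.sum W).gen i α) ∈ U.homog (shift i) := by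
  rw [gen_sum, map_add, symDesc_symInl, symDesc_symInr]
  exact Submodule.add_mem _ (hf i _) (hf' i _)

end

/-- An algebra map out of `Sym (V ⊕ W)` is compatible with differentials if it is so on generators
from `V` and `W`. -/
theorem symDesc_map_d (D : (V.sum W).Differential) (D' : U.Differential)
    (f : V.Sym →ₐ[ℝ] U.Sym) (hf : ∀ i α, f (V.gen i α) ∈ U.homog (shift i))
    (f' : W.Sym →ₐ[ℝ] U.Sym) (hf' : ∀ i α, f' (W.gen i α) ∈ U.homog (shift i))
    (hl : ∀ i α, symDesc f hf f' hf' (D.d (symInl V W (V.gen i α))) = D'.d (f (V.gen i α)))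
    (hr : ∀ i α, symDesc f hf f' hf' (D.d (symInr V W (W.gen i α))) = D'.d (f' (W.gen i α)))
    (a : (V.sum W).Sym) : symDesc f hf f' hf' (D.d a) = D'.d (symDesc f hf f' hf' a) :=
  D.isOddDerivation.intertwine D'.isOddDerivation _ (symDesc_gen_mem_homog f hf f' hf')
    (fun i α => by
      rw [gen_sum, map_add, map_add, map_add, symDesc_symInl, symDesc_symInr, map_add, hl, hr]) a

/-- A differential on `Sym V` extends to `Sym (V ⊕ W)` with prescribed closed values on the
generators from `W`. -/
theorem exists_differential_sum (D : V.Differential) (θ : W.ShiftedDual →ₗ[ℝ] (V.sum W).Sym)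
    (hθ : ∀ i α, θ (W.inDual i α) ∈ (V.sum W).homog (i.1 + 1 + 1, i.2))
    (h2 : ∀ δ : (V.sum W).Sym →ₗ[ℝ] (V.sum W).Sym, IsOddDerivation δ →
      (∀ a, δ (symInl V W a) = symInl V W (D.d a)) → (∀ w, δ (symInr V W (W.gens w)) = θ w) →
      ∀ i α, δ (θ (W.inDual i α)) = 0) :
    ∃ D' : (V.sum W).Differential, (∀ a, D'.d (symInl V W a) = symInl V W (D.d a)) ∧
      ∀ w, D'.d (symInr V W (W.gens w)) = θ w := by
  let Θ : (V.sum W).ShiftedDual →ₗ[ℝ] (V.sum W).Sym :=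
    (symInl V W).toLinearMap ∘ₗ D.d ∘ₗ V.gens ∘ₗ dualMap (sumInl V W) +
      θ ∘ₗ dualMap (sumInr V W)
  have hΘ (v) : Θ v = symInl V W (D.d (V.gens (dualMap (sumInl V W) v))) +
    θ (dualMap (sumInr V W) v) := rfl
  have hl : ∀ δ : (V.sum W).Sym →ₗ[ℝ] (V.sum W).Sym, IsOddDerivation δ →
      -- Both sides, as functions of `a`, are governed by their values on generators of `V`, since
      -- `symInl` intertwines odd derivations as soon as it does so there.
      (∀ v, δ ((V.sum W).gens v) = Θ v) → ∀ a, δ (symInl V W a) = symInl V W (D.d a) := by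
    intro δ hδ h a
    refine (D.isOddDerivation.intertwine hδ _ (symMap_gen_mem_homog _) (fun i α => ?_) a).symm
    rw [gen, symMap_gens, h, hΘ, dualMap_sumInl_sumFst, dualMap_sumInr_sumFst, map_zero,
      add_zero]
    rfl
  have hr : ∀ δ : (V.sum W).Sym →ₗ[ℝ] (V.sum W).Sym,
      (∀ v, δ ((V.sum W).gens v) = Θ v) → ∀ w, δ (symInr V W (W.gens w)) = θ w := by
    intro δ h w
    rw [symInr, symMap_gens, h, hΘ, dualMap_sumInl_sumSnd, dualMap_sumInr_sumSnd, map_zero,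
      map_zero, map_zero, zero_add]
  obtain ⟨D', hD'⟩ := exists_differential Θ (fun i α => by
      rw [hΘ, dualMap_inDual, dualMap_inDual]
      exact Submodule.add_mem _ (symMap_mem_homog _
        (D.map_homog _ _ _ (V.gen_mem_homog i _))) (hθ i _)) (fun δ hδ h i α => by
      rw [hΘ, dualMap_inDual, dualMap_inDual, map_add, hl δ hδ h, D.sq_zero, map_zero, zero_add]
      exact h2 δ hδ (hl δ hδ h) (hr δ h) i _)
  exact ⟨D', hl D'.d D'.isOddDerivation hD', hr D'.d hD'⟩

/-! ### The line -/

/-- The component `(n, 0)` is `ℝ` with basis the unit; every other component is zero, where both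
sides vanish. -/
theorem line_eq_smul_lineUnit (n : ℕ) (i : ℕ × ZMod 2) (x : (line n).carrier i.1 i.2) :
    x = lineCoord n i x • lineUnit n i := by
  refine Subtype.ext ?_
  change x.1 = x.1 * (if i.1 = n ∧ i.2 = 0 then 1 else 0)
  split_ifs with h
  · rw [mul_one]
  · have hp : ∀ p : Submodule ℝ ℝ, p = ⊥ → ∀ y : p, y.1 = 0 := by
      rintro _ rfl y
      exact y.2
    rw [mul_zero]
    exact hp _ (if_neg h) x

/-- The value of a linear combination of generators on the unit element of the line. -/
def lineEval (n : ℕ) : (line n).ShiftedDual →ₗ[ℝ] ℝ :=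
  DirectSum.toModule ℝ _ _ fun i =>
    Module.Dual.eval ℝ ((line n).carrier i.1 i.2) (lineUnit n i)

theorem lineEval_inDual (n : ℕ) (i : ℕ × ZMod 2)
    (α : Module.Dual ℝ ((line n).carrier i.1 i.2)) :
    lineEval n ((line n).inDual i α) = α (lineUnit n i) := by
  rw [lineEval, inDual, DirectSum.toModule_lof]
  rfl

/-- The coordinate on the line, as an element of the space of generators. -/
def lineVec (n : ℕ) : (line n).ShiftedDual := (line n).inDual (n, 0) (lineCoord n (n, 0))

theorem gens_lineVec (n : ℕ) : (line n).gens (lineVec n) = lineGen n := rfl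

theorem eq_lineEval_smul_lineVec (n : ℕ) (v : (line n).ShiftedDual) :
    v = lineEval n v • lineVec n := by
  refine LinearMap.congr_fun (f := LinearMap.id)
    (g := (lineEval n).smulRight (lineVec n)) (shiftedDual_hom_ext fun i α => ?_) v
  simp only [LinearMap.id_apply, LinearMap.smulRight_apply, lineEval_inDual]
  by_cases hi : i = (n, 0)
  · subst hi
    rw [lineVec, ← map_smul]
    congr 1
    refine LinearMap.ext fun x => ?_
    conv_lhs => rw [line_eq_smul_lineUnit n (n, 0) x, map_smul]
    exact mul_comm _ _
  · have h0 : α = 0 := LinearMap.ext fun x => by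
      rw [line_eq_smul_lineUnit n i x, lineUnit_of_ne n i hi]; simp
    simp [h0]

theorem lineVec_ne_zero (n : ℕ) : lineVec n ≠ 0 := fun h => by
  have h1 := lineEval_inDual n (n, 0) (lineCoord n (n, 0))
  rw [lineCoord_lineUnit] at h1
  exact one_ne_zero (h1.symm.trans ((congrArg _ h).trans (map_zero _)))

theorem lineGen_mem_homog (n : ℕ) : lineGen n ∈ (line n).homog (n + 1, 0) :=
  (line n).gen_mem_homog (n, 0) _

theorem line_gen (n : ℕ) (i : ℕ × ZMod 2) (α : Module.Dual ℝ ((line n).carrier i.1 i.2)) :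
    (line n).gen i α = α (lineUnit n i) • lineGen n := by
  rw [gen, eq_lineEval_smul_lineVec n ((line n).inDual i α), map_smul, lineEval_inDual,
    gens_lineVec]

theorem lineLift_gen_mem_homog (V : GradedSuperSpace) (n : ℕ) (μ : V.Sym)
    (hμ : μ ∈ V.homog (n + 1, 0)) (i : ℕ × ZMod 2)
    (α : Module.Dual ℝ ((line n).carrier i.1 i.2)) :
    V.lineLift n μ hμ ((line n).gen i α) ∈ V.homog (shift i) :=
  V.lineLift_mem_homog n μ hμ ((line n).gen_mem_homog i α)

end GradedSuperSpace

namespace SuperLInfAlgebra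

variable {g h k : SuperLInfAlgebra}

/-! ### Products -/

theorem exists_prod_diff (g h : SuperLInfAlgebra) :
    ∃ D : (g.space.sum h.space).Differential,
      (∀ a, D.d (symInl g.space h.space a) = symInl g.space h.space (g.d a)) ∧
      ∀ a, D.d (symInr g.space h.space a) = symInr g.space h.space (h.d a) := by
  have hr : ∀ δ : (g.space.sum h.space).Sym →ₗ[ℝ] (g.space.sum h.space).Sym, IsOddDerivation δ →
      (∀ w, δ (symInr g.space h.space (h.space.gens w)) =
        symInr g.space h.space (h.d (h.space.gens w))) →
      ∀ a, δ (symInr g.space h.space a) = symInr g.space h.space (h.d a) := fun δ hδ H a =>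
    (h.diff.isOddDerivation.intertwine hδ _ (symMap_gen_mem_homog _)
      (fun i α => (H _).symm) a).symm
  obtain ⟨D, hl, hD⟩ := exists_differential_sum (W := h.space) g.diff
    ((symInr g.space h.space).toLinearMap ∘ₗ h.d ∘ₗ h.space.gens)
    (fun i α => symMap_mem_homog _ (h.diff.map_homog _ _ _ (h.space.gen_mem_homog i α)))
    (fun δ hδ _ H i α => by
      exact (hr δ hδ H _).trans ((congrArg _ (h.diff.sq_zero _)).trans (map_zero _)))
  exact ⟨D, hl, hr D.d D.isOddDerivation hD⟩

/-- The differential of the product. -/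
def prodDiff (g h : SuperLInfAlgebra) : (g.space.sum h.space).Differential :=
  (exists_prod_diff g h).choose

/-- The product of two super `L_∞`-algebras. -/
abbrev prod (g h : SuperLInfAlgebra) : SuperLInfAlgebra :=
  ⟨g.space.sum h.space, prodDiff g h⟩

theorem prod_d_symInl (a : g.CE) :
    (prodDiff g h).d (symInl g.space h.space a) = symInl g.space h.space (g.d a) :=
  (exists_prod_diff g h).choose_spec.1 a

theorem prod_d_symInr (a : h.CE) :
    (prodDiff g h).d (symInr g.space h.space a) = symInr g.space h.space (h.d a) :=
  (exists_prod_diff g h).choose_spec.2 a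

/-- The first projection. -/
def prodFst (g h : SuperLInfAlgebra) : g.prod h ⟶ g :=
  Hom.mk (g := g.prod h) (h := g) (symInl g.space h.space) (fun _ _ ha => symMap_mem_homog _ ha)
    (fun a => (prod_d_symInl a).symm)

/-- The second projection. -/
def prodSnd (g h : SuperLInfAlgebra) : g.prod h ⟶ h :=
  Hom.mk (g := g.prod h) (h := h) (symInr g.space h.space) (fun _ _ ha => symMap_mem_homog _ ha)
    (fun a => (prod_d_symInr a).symm)

/-- The homomorphism to a product with given components. -/
def prodLift (f : k ⟶ g) (f' : k ⟶ h) : k ⟶ g.prod h :=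
  Hom.mk (g := k) (h := g.prod h)
    (symDesc (Hom.toAlgHom f) (gen_map_mem_homog f) (Hom.toAlgHom f') (gen_map_mem_homog f'))
    (fun _ _ ha => map_homog_of_gen _ (symDesc_gen_mem_homog _ _ _ _) ha)
    (symDesc_map_d (prodDiff g h) k.diff _ _ _ _
      (fun i α => by rw [prod_d_symInl, symDesc_symInl, Hom.map_d])
      (fun i α => by rw [prod_d_symInr, symDesc_symInr, Hom.map_d]))

theorem prodLift_fst (f : k ⟶ g) (f' : k ⟶ h) : prodLift f f' ≫ prodFst g h = f :=
  Hom.ext (AlgHom.ext fun a => symDesc_symInl (Hom.toAlgHom f)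
    (gen_map_mem_homog f) (Hom.toAlgHom f') (gen_map_mem_homog f') a)

theorem prodLift_snd (f : k ⟶ g) (f' : k ⟶ h) : prodLift f f' ≫ prodSnd g h = f' :=
  Hom.ext (AlgHom.ext fun a => symDesc_symInr (Hom.toAlgHom f)
    (gen_map_mem_homog f) (Hom.toAlgHom f') (gen_map_mem_homog f') a)

theorem prod_hom_ext {f f' : k ⟶ g.prod h} (h₁ : f ≫ prodFst g h = f' ≫ prodFst g h)
    (h₂ : f ≫ prodSnd g h = f' ≫ prodSnd g h) : f = f' :=
  Hom.ext (sum_hom_ext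
    (fun i α => AlgHom.congr_fun (congrArg Hom.toAlgHom h₁) (g.space.gen i α))
    (fun i α => AlgHom.congr_fun (congrArg Hom.toAlgHom h₂) (h.space.gen i α)))

/-- The pullback of the projection `h × a ⟶ h` along `f : g ⟶ h` is the projection
`g × a ⟶ g`. -/
theorem isPullback_prodFst (f : g ⟶ h) (a : SuperLInfAlgebra) :
    IsPullback (prodLift (prodFst g a ≫ f) (prodSnd g a)) (prodFst g a) (prodFst h a) f := by
  refine ⟨⟨prodLift_fst _ _⟩, ⟨Limits.PullbackCone.IsLimit.mk _
    (fun s => prodLift s.snd (s.fst ≫ prodSnd h a)) (fun s => ?_)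
    (fun s => prodLift_fst _ _) (fun s m h₁ h₂ => ?_)⟩⟩
  · refine prod_hom_ext ?_ ?_
    · rw [Category.assoc, prodLift_fst, ← Category.assoc, prodLift_fst, s.condition]
    · rw [Category.assoc, prodLift_snd, prodLift_snd]
  · refine prod_hom_ext ?_ ?_
    · rw [prodLift_fst, h₂]
    · rw [prodLift_snd, ← h₁, Category.assoc, prodLift_snd]

/-! ### Acyclic algebras -/

/-- The unary bracket of `g` is acyclic. -/
def IsAcyclic (g : SuperLInfAlgebra) : Prop :=
  ∀ v, g.unary v = 0 → ∃ u, v = g.unary u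

instance : Subsingleton point.space.ShiftedDual :=
  ⟨fun v w => DFinsupp.ext fun i => LinearMap.ext fun x => by
    rw [show x = 0 from rfl, map_zero, map_zero]⟩

/-- The point has no generators: the surjectivity condition is empty, and in the injectivity
condition every class maps to an exact one. -/
theorem isWeakEquivalence_point_iff (f : point ⟶ g) : IsWeakEquivalence f ↔ g.IsAcyclic :=
  ⟨fun hf v hv => hf.1 v hv ⟨0, Subsingleton.elim _ _⟩,
    fun hg => ⟨fun v hv _ => hg v hv, fun _ _ => ⟨0, map_zero _, 0, Subsingleton.elim _ _⟩⟩⟩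

/-- The homomorphism from the trivial algebra. -/
def fromPoint (g : SuperLInfAlgebra) : point ⟶ g :=
  Hom.ofGens (g := point) (h := g) 0 (fun _ _ => Submodule.zero_mem _) fun i α => by
    -- The differential of a generator has positive degree, hence no constant term, so the map
    -- killing all generators kills it.
    have h : ∀ a ∈ g.space.lengthFiltration 1 (i.1 + 1 + 1, i.2),
        liftGraded (V := point.space) (W := g.space) 0 (fun _ _ => Submodule.zero_mem _) a = 0 := by
      intro a ha
      induction ha using Submodule.span_induction with
      | zero => rw [map_zero]
      | add x y _ _ hx hy => rw [map_add, hx, hy, add_zero]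
      | smul r x _ hx => rw [map_smul, hx, smul_zero]
      | mem x hx =>
        obtain ⟨l, hl, -, rfl⟩ := hx
        match l, hl with
        | y :: l, _ => rw [monomial_cons, map_mul, gen, liftGraded_gens, LinearMap.zero_apply,
            zero_mul]
    rw [h _ (homog_le_lengthFiltration_one _ _
      (g.diff.map_homog _ _ _ (g.space.gen_mem_homog i α))), LinearMap.zero_apply, map_zero]

theorem linear_prodFst (v : g.space.ShiftedDual) :
    Hom.linear (prodFst g h) v = dualMap (sumFst g.space h.space) v :=
  linearComponent_symMap _ v

theorem linear_prodSnd (v : h.space.ShiftedDual) :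
    Hom.linear (prodSnd g h) v = dualMap (sumSnd g.space h.space) v :=
  linearComponent_symMap _ v

/-- The complex of generators of the product is the direct sum of the two complexes, and the second
summand is exact. -/
theorem isWeakEquivalence_prodFst (g : SuperLInfAlgebra) {a : SuperLInfAlgebra}
    (ha : a.IsAcyclic) : IsWeakEquivalence (prodFst g a) := by
  have hl : ∀ v, (g.prod a).unary (dualMap (sumFst g.space a.space) v) =
      dualMap (sumFst g.space a.space) (g.unary v) := fun v => by
    rw [← linear_prodFst, ← linear_prodFst, linear_unary]
  have hr : ∀ v, (g.prod a).unary (dualMap (sumSnd g.space a.space) v) =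
      dualMap (sumSnd g.space a.space) (a.unary v) := fun v => by
    rw [← linear_prodSnd, ← linear_prodSnd, linear_unary]
  have hdec : ∀ v : (g.space.sum a.space).ShiftedDual, (g.prod a).unary v =
      dualMap (sumFst g.space a.space) (g.unary (dualMap (sumInl g.space a.space) v)) +
      dualMap (sumSnd g.space a.space) (a.unary (dualMap (sumInr g.space a.space) v)) := fun v => by
    rw [← hl, ← hr, ← map_add, dualMap_sum]
  constructor
  · rintro v - ⟨u, hu⟩
    refine ⟨dualMap (sumInl g.space a.space) u, ?_⟩
    have h := congrArg (dualMap (sumInl g.space a.space)) hu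
    rwa [linear_prodFst, dualMap_sumInl_sumFst, hdec, map_add, dualMap_sumInl_sumFst,
      dualMap_sumInl_sumSnd, add_zero] at h
  · intro w hw
    have h := hw
    rw [hdec] at h
    have h1 := congrArg (dualMap (sumInl g.space a.space)) h
    have h2 := congrArg (dualMap (sumInr g.space a.space)) h
    rw [map_add, dualMap_sumInl_sumFst, dualMap_sumInl_sumSnd, add_zero, map_zero] at h1
    rw [map_add, dualMap_sumInr_sumFst, dualMap_sumInr_sumSnd, zero_add, map_zero] at h2
    obtain ⟨u, hu⟩ := ha _ h2
    refine ⟨_, h1, dualMap (sumSnd g.space a.space) u, ?_⟩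
    rw [linear_prodFst, hr, ← hu, dualMap_sum]

end SuperLInfAlgebra
-- The extension by a cocycle and its universal property.
namespace GradedSuperSpace

theorem lineEval_lineVec (n : ℕ) : lineEval n (lineVec n) = 1 := by
  rw [lineVec, lineEval_inDual, lineCoord_lineUnit]

end GradedSuperSpace

namespace SuperLInfAlgebra

variable {g h k : SuperLInfAlgebra} {n : ℕ}

theorem extGen_mem_homog (g : SuperLInfAlgebra) (hn : 1 ≤ n) :
    g.extGen n ∈ (g.extSpace n).homog (n, 0) := by
  have h := symMap_mem_homog (sumSnd g.space (line (n - 1))) (lineGen_mem_homog (n - 1))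
  rw [Nat.sub_add_cancel hn] at h
  exact h

theorem symInr_line_gen (V : GradedSuperSpace) (i : ℕ × ZMod 2)
    (α : Module.Dual ℝ ((line n).carrier i.1 i.2)) :
    symInr V (line n) ((line n).gen i α) = α (lineUnit n i) • symInr V (line n) (lineGen n) := by
  rw [line_gen, map_smul]

/-- There is exactly one differential with `d c_n = μ`. -/
theorem existsUnique_isExtDifferential (g : SuperLInfAlgebra) (hn : 1 ≤ n) {μ : g.CE}
    (hμ : g.IsCocycle (n + 1) μ) :
    ∃! D : (g.extSpace n).Differential, g.IsExtDifferential n μ D := by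
  obtain ⟨D, hl, hr⟩ := exists_differential_sum (W := line (n - 1)) g.diff
    ((lineEval (n - 1)).smulRight (symInl g.space (line (n - 1)) μ))
    (fun i α => by
      rw [LinearMap.smulRight_apply, lineEval_inDual]
      by_cases hi : i = (n - 1, 0)
      · subst hi
        refine Submodule.smul_mem _ _ ?_
        have h := symMap_mem_homog (sumFst g.space (line (n - 1))) hμ.mem_homog
        rwa [← Nat.sub_add_cancel hn] at h
      · rw [lineUnit_of_ne _ i hi, map_zero, zero_smul]
        exact Submodule.zero_mem _)
    (fun δ _ hδ _ i α => by
      rw [LinearMap.smulRight_apply, map_smul, hδ]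
      change _ • symInl g.space (line (n - 1)) (g.d μ) = 0
      rw [hμ.closed, map_zero, smul_zero])
  refine ⟨D, ⟨hl, ?_⟩, fun D' hD' => ?_⟩
  · refine (hr (lineVec (n - 1))).trans ?_
    rw [LinearMap.smulRight_apply, lineEval_lineVec, one_smul]
    rfl
  -- Two odd derivations agree once they agree on the generators of `g` and of the line; the latter
  -- are scalar multiples of `c_n`.
  · refine GradedSuperSpace.Differential.ext (IsOddDerivation.ext_sum (V := g.space) (W := line (n - 1))
      D'.isOddDerivation D.isOddDerivation
      (fun i α => (hD'.1 _).trans (hl _).symm) (fun i α => ?_))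
    have h1 : D'.d (symInr g.space (line (n - 1)) (lineGen (n - 1))) =
      symInl g.space (line (n - 1)) μ := hD'.2
    have h2 : D.d (symInr g.space (line (n - 1)) (lineGen (n - 1))) =
        symInl g.space (line (n - 1)) μ := by
      refine (hr (lineVec (n - 1))).trans ?_
      rw [LinearMap.smulRight_apply, lineEval_lineVec, one_smul]
    rw [symInr_line_gen]
    exact (map_smul D'.d _ _).trans (((congrArg _ (h1.trans h2.symm))).trans
      (map_smul D.d _ _).symm)

variable {μ : g.CE} {D : (g.extSpace n).Differential}

theorem proj_toAlgHom (hD : g.IsExtDifferential n μ D) (a : g.CE) :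
    Hom.toAlgHom hD.proj a = g.extIncl n a := rfl

theorem symDesc_lineLift_map_d {m : ℕ} (D : (g.space.sum (line m)).Differential)
    (hl : ∀ a, D.d (symInl g.space (line m) a) = symInl g.space (line m) (g.d a))
    (hr : D.d (symInr g.space (line m) (lineGen m)) = symInl g.space (line m) μ)
    (p : k ⟶ g) (γ : k.CE) (hγ : γ ∈ k.space.homog (m + 1, 0)) (hd : k.d γ = Hom.toAlgHom p μ)
    (a : (g.space.sum (line m)).Sym) :
    symDesc (Hom.toAlgHom p) (gen_map_mem_homog p) (k.space.lineLift m γ hγ)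
      (lineLift_gen_mem_homog _ _ _ hγ) (D.d a) =
    k.d (symDesc (Hom.toAlgHom p) (gen_map_mem_homog p) (k.space.lineLift m γ hγ)
      (lineLift_gen_mem_homog _ _ _ hγ) a) :=
  symDesc_map_d D k.diff _ _ _ _
    (fun i α => by rw [hl, symDesc_symInl, Hom.map_d])
    (fun i α => by
      rw [symInr_line_gen, map_smul, hr, map_smul, symDesc_symInl, ← hd, lineLift_gen, map_smul]) a

/-- A homomorphism to the extension, from a homomorphism `p` to the base and a trivialization of
the pullback of the cocycle along `p`. -/
def extLift (hn : 1 ≤ n) (hD : g.IsExtDifferential n μ D) (p : k ⟶ g) (γ : k.CE)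
    (hγ : γ ∈ k.space.homog (n, 0)) (hd : k.d γ = Hom.toAlgHom p μ) :
    k ⟶ ⟨g.extSpace n, D⟩ :=
  -- The subtraction in `n - 1` is truncated; `1 ≤ n` gives the adjoined generator degree `n` rather
  -- than 1.
  have hγ' : γ ∈ k.space.homog (n - 1 + 1, 0) := by rwa [Nat.sub_add_cancel hn]
  Hom.mk (g := k) (h := ⟨g.space.sum (line (n - 1)), D⟩)
    (symDesc (Hom.toAlgHom p) (gen_map_mem_homog p) (k.space.lineLift (n - 1) γ hγ')
      (lineLift_gen_mem_homog _ _ _ hγ'))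
    (fun _ _ ha => map_homog_of_gen _ (symDesc_gen_mem_homog _ _ _ _) ha)
    (symDesc_lineLift_map_d D hD.1 hD.2 p γ hγ' hd)

theorem extLift_proj (hn : 1 ≤ n) (hD : g.IsExtDifferential n μ D) (p : k ⟶ g) (γ : k.CE)
    (hγ : γ ∈ k.space.homog (n, 0)) (hd : k.d γ = Hom.toAlgHom p μ) :
    extLift hn hD p γ hγ hd ≫ hD.proj = p :=
  Hom.ext (AlgHom.ext fun a => symDesc_symInl (W := line (n - 1)) _ (gen_map_mem_homog p) _
    (lineLift_gen_mem_homog _ _ _ (by rwa [Nat.sub_add_cancel hn])) a)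

theorem extLift_extGen (hn : 1 ≤ n) (hD : g.IsExtDifferential n μ D) (p : k ⟶ g) (γ : k.CE)
    (hγ : γ ∈ k.space.homog (n, 0)) (hd : k.d γ = Hom.toAlgHom p μ) :
    Hom.toAlgHom (extLift hn hD p γ hγ hd) (g.extGen n) = γ := by
  have hγ' : γ ∈ k.space.homog (n - 1 + 1, 0) := by rwa [Nat.sub_add_cancel hn]
  exact (symDesc_symInr (W := line (n - 1)) _ (gen_map_mem_homog p) _
    (lineLift_gen_mem_homog _ _ _ hγ') (lineGen (n - 1))).trans
    (k.space.lineLift_lineGen (n - 1) γ hγ')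

/-- Together with `extLift` this is the universal property: maps to the extension are pairs of a map
to the base and a trivialization of the pulled back cocycle. -/
theorem ext_hom_ext (hD : g.IsExtDifferential n μ D) {f f' : k ⟶ ⟨g.extSpace n, D⟩}
    (h₁ : f ≫ hD.proj = f' ≫ hD.proj)
    (h₂ : Hom.toAlgHom f (g.extGen n) = Hom.toAlgHom f' (g.extGen n)) : f = f' := by
  refine Hom.ext (sum_hom_ext (V := g.space) (W := line (n - 1))
    (fun i α => AlgHom.congr_fun (congrArg Hom.toAlgHom h₁) (g.space.gen i α)) (fun i α => ?_))
  rw [symInr_line_gen]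
  exact (map_smul (Hom.toAlgHom f) _ _).trans
    ((congrArg _ h₂).trans (map_smul (Hom.toAlgHom f') _ _).symm)

/-- The extension by the pullback of a cocycle is the pullback of the extension. -/
theorem exists_isPullback_proj (hn : 1 ≤ n) (hD : g.IsExtDifferential n μ D) {ν : h.CE}
    {D' : (h.extSpace n).Differential} (hD' : h.IsExtDifferential n ν D') (f : g ⟶ h)
    (hf : Hom.toAlgHom f ν = μ) :
    ∃ t, IsPullback t hD.proj hD'.proj f := by
  have hd : D.d (g.extGen n) = Hom.toAlgHom (hD.proj ≫ f) ν := by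
    rw [comp_toAlgHom_apply, hf, proj_toAlgHom]
    exact hD.2
  -- Given a map to `g` and a map to the extension of `h` with the same image in `h`, the image of
  -- the generator over `h` trivializes the pullback of `μ`. This is the datum for a map to the
  -- extension of `g`.
  refine ⟨extLift hn hD' (hD.proj ≫ f) (g.extGen n) (extGen_mem_homog g hn) hd,
    ⟨extLift_proj _ _ _ _ _ _⟩, ⟨Limits.PullbackCone.IsLimit.mk _
    (fun s => extLift hn hD s.snd (Hom.toAlgHom s.fst (h.extGen n))
      (Hom.map_homog s.fst _ _ (extGen_mem_homog h hn)) ?_) (fun s => ?_)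
    (fun s => extLift_proj _ _ _ _ _ _) (fun s m h₁ h₂ => ?_)⟩⟩
  · rw [← Hom.map_d]
    refine (congrArg (Hom.toAlgHom s.fst) hD'.2).trans ?_
    refine (AlgHom.congr_fun (congrArg Hom.toAlgHom s.condition) ν).trans ?_
    rw [comp_toAlgHom_apply, hf]
  · refine ext_hom_ext hD' ?_ ?_
    · rw [Category.assoc, extLift_proj, ← Category.assoc, extLift_proj, s.condition]
    · rw [comp_toAlgHom_apply, extLift_extGen, extLift_extGen]
  · refine ext_hom_ext hD ?_ ?_
    · rw [extLift_proj, h₂]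
    · rw [extLift_extGen, ← h₁, comp_toAlgHom_apply, extLift_extGen]

theorem linear_proj (hD : g.IsExtDifferential n μ D) (v : g.space.ShiftedDual) :
    Hom.linear hD.proj v = dualMap (sumFst g.space (line (n - 1))) v :=
  linearComponent_symMap (sumFst g.space (line (n - 1))) v

theorem isFibration_proj (hD : g.IsExtDifferential n μ D) : IsFibration hD.proj := by
  intro v w hvw
  rw [linear_proj, linear_proj] at hvw
  rw [← dualMap_sumInl_sumFst (W := line (n - 1)) v, hvw, dualMap_sumInl_sumFst]

theorem isCocycle_lineGen (n : ℕ) : (lineAlgebra n).IsCocycle (n + 1) (lineGen n) :=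
  ⟨lineGen_mem_homog n, rfl⟩

/-- The extension of `ℝ[n]` by its generator is acyclic. -/
theorem isAcyclic_ext_line {D : ((lineAlgebra n).extSpace n).Differential}
    (hD : (lineAlgebra n).IsExtDifferential n (lineGen n) D) :
    IsAcyclic ⟨(lineAlgebra n).extSpace n, D⟩ := by
  let fst := dualMap (sumFst (line n) (line (n - 1)))
  let snd := dualMap (sumSnd (line n) (line (n - 1)))
  let E : SuperLInfAlgebra := ⟨(line n).sum (line (n - 1)), D⟩
  have hfst : E.unary (fst (lineVec n)) = 0 := by
    rw [unary_apply, ← symMap_gens]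
    refine (congrArg _ (hD.1 (lineGen n))).trans ?_
    exact (congrArg _ (map_zero (AlgHom.toLinearMap _))).trans (map_zero _)
  -- The complex of generators has the basis `c`, `b`, and the unary bracket sends `c` to `b`; a
  -- closed vector has no `c`-component and is a multiple of `b`.
  have hsnd : E.unary (snd (lineVec (n - 1))) = fst (lineVec n) := by
    rw [unary_apply, ← symMap_gens]
    refine (congrArg _ hD.2).trans ?_
    exact linearComponent_symMap _ (lineVec n)
  suffices H : E.IsAcyclic from H
  intro v hv
  have hv' : v = lineEval n (dualMap (sumInl _ _) v) • fst (lineVec n) +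
      lineEval (n - 1) (dualMap (sumInr _ _) v) • snd (lineVec (n - 1)) := by
    rw [← map_smul, ← map_smul, ← eq_lineEval_smul_lineVec, ← eq_lineEval_smul_lineVec]
    exact (dualMap_sum v).symm
  generalize lineEval n (dualMap (sumInl _ _) v) = x at hv'
  generalize lineEval (n - 1) (dualMap (sumInr _ _) v) = y at hv'
  subst hv'
  rw [map_add, map_smul, map_smul, hfst, hsnd, smul_zero, zero_add, ← map_smul] at hv
  have hy : y • lineVec n = 0 := by
    rw [← dualMap_sumInl_sumFst (W := line (n - 1)) (y • lineVec n)]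
    exact (congrArg _ hv).trans (map_zero _)
  rw [smul_eq_zero, or_iff_left (lineVec_ne_zero n)] at hy
  refine ⟨x • snd (lineVec (n - 1)), ?_⟩
  rw [map_smul, hsnd, hy, zero_smul, add_zero]

end SuperLInfAlgebra

/-! ### Contracting homotopies and the vanishing of cohomology. -/

/-- An acyclic linear differential has a contracting homotopy. -/
theorem exists_linear_contraction {K M : Type*} [Field K] [AddCommGroup M] [Module K M] (d : M →ₗ[K] M)
    (hd : ∀ v, d (d v) = 0) (hex : ∀ v, d v = 0 → ∃ u, v = d u) :
    ∃ h : M →ₗ[K] M, ∀ v, d (h v) + h (d v) = v := by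
  obtain ⟨T, hT⟩ := d.rangeRestrict.exists_rightInverse_of_surjective d.range_rangeRestrict
  obtain ⟨p, hp⟩ := (LinearMap.range d).subtype.exists_leftInverse_of_injective
    (LinearMap.range d).ker_subtype
  -- `T` splits `d` onto its range and `p` retracts the whole space onto that range, so that `d s d
  -- = d`.
  let s := T ∘ₗ p
  have hs : ∀ v, d (s (d v)) = d v := fun v => by
    have h1 : p (d v) = d.rangeRestrict v := LinearMap.congr_fun hp (d.rangeRestrict v)
    have h2 := congrArg Subtype.val (LinearMap.congr_fun hT (d.rangeRestrict v))
    change d (T (p (d v))) = d v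
    rw [h1]
    exact h2
  -- By exactness `v - s (d v)` is of the form `d u`, hence is fixed by `d s`. This reads `v = d s v
  -- + s d v - d s s d v`, which forces the correction term `d s s`.
  refine ⟨s - d ∘ₗ s ∘ₗ s, fun v => ?_⟩
  simp only [LinearMap.sub_apply, LinearMap.comp_apply, map_sub, hd, sub_zero]
  obtain ⟨u, hu⟩ := hex (v - s (d v)) (by rw [map_sub, hs, sub_self])
  have h := hs u
  rw [← hu, map_sub, map_sub] at h
  have h' : v = d (s v) - d (s (s (d v))) + s (d v) := sub_eq_iff_eq_add.1 h.symm
  conv_rhs => rw [h']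
  abel

namespace GradedSuperSpace

variable {V : GradedSuperSpace}

/-- An odd derivation induced by a map of degree `-1` on generators respects the length
filtration. -/
theorem IsOddDerivation.map_lengthFiltration_of_lowers {H : V.Sym →ₗ[ℝ] V.Sym}
    (hH : IsOddDerivation H) (h0 : ∀ s α, H (V.gen (0, s) α) = 0)
    (h1 : ∀ k s α, H (V.gen (k + 1, s) α) ∈ V.homog (k + 1, s)) {N k : ℕ} {s : ZMod 2} {a : V.Sym}
    (ha : a ∈ V.lengthFiltration N (k + 1, s)) : H a ∈ V.lengthFiltration N (k, s) := by
  -- Generators from component `0` have degree one and could only be lowered to constants. `H` is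
  -- zero on them, and so never shortens words.
  have hgen : ∀ (i : ℕ × ZMod 2) α, H (V.gen i α) ∈ V.lengthFiltration 1 i := by
    rintro ⟨k, s⟩ α
    rcases k with - | k
    · rw [h0]; exact Submodule.zero_mem _
    · exact homog_le_lengthFiltration_one k s (h1 k s α)
  have hl : ∀ l k s, V.monomialDegree l = (k + 1, s) →
      H (V.monomial l) ∈ V.lengthFiltration l.length (k, s) := by
    intro l
    induction l with
    | nil =>
      intro k s h
      simpa [monomialDegree_nil] using congrArg Prod.fst h
    | cons x l ih =>
      intro k s h
      rw [monomialDegree_cons] at h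
      rw [monomial_cons, hH.map_gen_mul, List.length_cons, add_comm l.length]
      refine Submodule.add_mem _ ?_ (Submodule.smul_mem _ _ ?_)
      · have := mul_mem_lengthFiltration (hgen x.1 x.2)
          (monomial_mem_lengthFiltration (le_refl l.length))
        convert this using 2
        have h1 := congrArg Prod.fst h
        have h2 := congrArg Prod.snd h
        simp only [shift, Prod.fst_add, Prod.snd_add] at h1 h2
        ext
        · simp only [Prod.fst_add]; omega
        · exact h2.symm
      · rcases l with - | ⟨y, l⟩
        · rw [monomial_nil, hH.map_one, mul_zero]
          exact Submodule.zero_mem _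
        · have hdeg : ∃ b, V.monomialDegree (y :: l) = (b + 1, (V.monomialDegree (y :: l)).2) := by
            have := length_le_monomialDegree (y :: l)
            rw [List.length_cons] at this
            exact ⟨(V.monomialDegree (y :: l)).1 - 1, Prod.ext (by simp only; omega) rfl⟩
          obtain ⟨b, hb⟩ := hdeg
          have := mul_mem_lengthFiltration (gen_mem_lengthFiltration x.1 x.2) (ih _ _ hb)
          convert this using 2
          rw [hb] at h
          have h1 := congrArg Prod.fst h
          have h2 := congrArg Prod.snd h
          simp only [shift, Prod.fst_add, Prod.snd_add] at h1 h2
          ext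
          · simp only [shift, Prod.fst_add]; omega
          · exact h2.symm
  induction ha using Submodule.span_induction with
  | zero => rw [map_zero]; exact Submodule.zero_mem _
  | add x y _ _ hx hy => rw [map_add]; exact Submodule.add_mem _ hx hy
  | smul r x _ hx => rw [map_smul]; exact Submodule.smul_mem _ _ hx
  | mem x hx =>
    obtain ⟨l, hN, hl', rfl⟩ := hx
    exact lengthFiltration_anti hN _ (hl l k s hl')

/-- If the anticommutator of `D` with an odd derivation `H` of degree `-1` is the identity on
generators up to products, then it is multiplication by the length up to longer products. -/
theorem Differential.anticommutator_sub_mem (D : V.Differential) {H : V.Sym →ₗ[ℝ] V.Sym}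
    (hH : IsOddDerivation H) (h0 : ∀ s α, H (V.gen (0, s) α) = 0)
    (h1 : ∀ k s α, H (V.gen (k + 1, s) α) ∈ V.homog (k + 1, s))
    (hE : ∀ i α, D.d (H (V.gen i α)) + H (D.d (V.gen i α)) - V.gen i α ∈
      V.lengthFiltration 2 (shift i))
    {N : ℕ} {i : ℕ × ZMod 2} {a : V.Sym} (ha : a ∈ V.lengthFiltration N i) :
    D.d (H a) + H (D.d a) - (N : ℝ) • a ∈ V.lengthFiltration (N + 1) i := by
  have hgen : ∀ (i : ℕ × ZMod 2) α, H (V.gen i α) ∈ V.homog (i.1, i.2) := by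
    rintro ⟨k, s⟩ α
    rcases k with - | k
    · rw [h0]; exact Submodule.zero_mem _
    · exact h1 k s α
  -- The anticommutator of two odd derivations is an ungraded derivation: its mixed terms cancel in
  -- pairs.
  have hder : ∀ (i : ℕ × ZMod 2) α b, D.d (H (V.gen i α * b)) + H (D.d (V.gen i α * b)) =
      (D.d (H (V.gen i α)) + H (D.d (V.gen i α))) * b +
        V.gen i α * (D.d (H b) + H (D.d b)) := by
    intro i α b
    have hs : ((-1 : ℝ) ^ (i.1 + 1)) * (-1 : ℝ) ^ (i.1 + 1) = 1 := by
      rw [← mul_pow]; simp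
    rw [hH.map_gen_mul, D.isOddDerivation.map_gen_mul, map_add, map_add, map_smul, map_smul,
      D.leibniz _ _ _ _ (hgen i α), D.isOddDerivation.map_gen_mul, hH.map_gen_mul,
      hH _ _ _ _ (D.map_homog _ _ _ (V.gen_mem_homog i α)), smul_add, smul_add, smul_smul,
      smul_smul, hs, one_smul, one_smul, pow_succ, pow_succ, add_mul, mul_add]
    simp only [mul_neg, mul_one]
    rw [show -(-1 : ℝ) ^ i.1 = (-1 : ℝ) * (-1 : ℝ) ^ i.1 by ring, mul_smul, mul_smul]
    module
  have hl : ∀ l, D.d (H (V.monomial l)) + H (D.d (V.monomial l)) -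
      (l.length : ℝ) • V.monomial l ∈
        V.lengthFiltration (l.length + 1) (V.monomialDegree l) := by
    intro l
    induction l with
    | nil =>
      rw [monomial_nil, hH.map_one, D.d_one, map_zero, map_zero]
      simp
    | cons x l ih =>
      rw [monomial_cons, monomialDegree_cons, hder, List.length_cons]
      have e1 := mul_mem_lengthFiltration (hE x.1 x.2)
        (monomial_mem_lengthFiltration (le_refl l.length))
      have e2 := mul_mem_lengthFiltration (gen_mem_lengthFiltration x.1 x.2) ih
      rw [show 2 + l.length = l.length + 1 + 1 by ring] at e1
      rw [show 1 + (l.length + 1) = l.length + 1 + 1 by ring] at e2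
      convert Submodule.add_mem _ e1 e2 using 1
      rw [sub_mul, mul_sub, mul_smul_comm, Nat.cast_add, Nat.cast_one, add_smul, one_smul]
      abel
  induction ha using Submodule.span_induction with
  | zero => simp
  | add x y _ _ hx hy =>
    convert Submodule.add_mem _ hx hy using 1
    simp only [map_add, smul_add]
    abel
  | smul r x _ hx =>
    convert Submodule.smul_mem _ r hx using 1
    rw [map_smul, map_smul, map_smul, map_smul, smul_sub, smul_add, smul_comm r]
  | mem x hx =>
    obtain ⟨l, hN, rfl, rfl⟩ := hx
    -- A word longer than `N` already lies in the next step of the filtration, so the scalar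
    -- `l.length` may be replaced by `N`.
    rw [show (N : ℝ) = l.length + ((N : ℝ) - l.length) by ring, add_smul, ← sub_sub]
    refine Submodule.sub_mem _ (lengthFiltration_anti (by omega) _ (hl l)) ?_
    rcases hN.eq_or_lt with h | h
    · rw [h, sub_self, zero_smul]
      exact Submodule.zero_mem _
    · exact Submodule.smul_mem _ _ (monomial_mem_lengthFiltration h)

/-- Successive approximation: for closed `a` of length at least `N + 1`, the element `a - (N + 1)⁻¹
• D.d (H a)` is closed and consists of longer words. The number `r` bounds the remaining steps; at
`r = 0` the length exceeds the degree `k + 1`, so `a = 0`. -/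
theorem Differential.exists_eq_d (D : V.Differential) {H : V.Sym →ₗ[ℝ] V.Sym}
    (hH : IsOddDerivation H) (h0 : ∀ s α, H (V.gen (0, s) α) = 0)
    (h1 : ∀ k s α, H (V.gen (k + 1, s) α) ∈ V.homog (k + 1, s))
    (hE : ∀ i α, D.d (H (V.gen i α)) + H (D.d (V.gen i α)) - V.gen i α ∈
      V.lengthFiltration 2 (shift i)) {k : ℕ} {s : ZMod 2} (r : ℕ) :
    ∀ (N : ℕ) (a : V.Sym), k + 2 ≤ N + 1 + r → a ∈ V.lengthFiltration (N + 1) (k + 1, s) →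
      D.d a = 0 → ∃ b ∈ V.homog (k, s), D.d b = a := by
  induction r with
  | zero =>
    intro N a hN ha _
    rw [lengthFiltration_eq_bot (by simp only; omega), Submodule.mem_bot] at ha
    exact ⟨0, Submodule.zero_mem _, by rw [ha, map_zero]⟩
  | succ r ih =>
    intro N a hN ha hd
    have hN0 : ((N + 1 : ℕ) : ℝ) ≠ 0 := Nat.cast_ne_zero.2 N.succ_ne_zero
    have h := D.anticommutator_sub_mem hH h0 h1 hE ha
    rw [hd, map_zero, add_zero] at h
    have h' := Submodule.smul_mem _ (-((N + 1 : ℕ) : ℝ)⁻¹) h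
    obtain ⟨b, hb, hb'⟩ := ih (N + 1) _ (by omega) h' (by
      rw [map_smul, map_sub, map_smul, D.sq_zero, hd, smul_zero, sub_zero, smul_zero])
    have hHa := lengthFiltration_le_homog _ _ (hH.map_lengthFiltration_of_lowers h0 h1 ha)
    refine ⟨b + ((N + 1 : ℕ) : ℝ)⁻¹ • H a,
      Submodule.add_mem _ hb (Submodule.smul_mem _ _ hHa), ?_⟩
    rw [map_add, hb', map_smul, smul_sub, smul_smul, neg_mul, inv_mul_cancel₀ hN0, neg_one_smul,
      neg_smul]
    abel

end GradedSuperSpace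

namespace SuperLInfAlgebra

variable {g : SuperLInfAlgebra}

/-- The unary bracket of an acyclic algebra has a contracting homotopy of degree `-1`. -/
theorem IsAcyclic.exists_contraction (hg : g.IsAcyclic) :
    ∃ h : g.space.ShiftedDual →ₗ[ℝ] g.space.ShiftedDual,
      (∀ s α, h (g.space.inDual (0, s) α) = 0) ∧
      (∀ k s α, ∃ α', h (g.space.inDual (k + 1, s) α) = g.space.inDual (k, s) α') ∧
      ∀ v, g.unary (h v) + h (g.unary v) = v := by
  have hex : ∀ v, g.unary v = 0 → ∃ u, v = g.unary u := hg
  obtain ⟨h, hh⟩ := exists_linear_contraction (K := ℝ) (M := g.space.ShiftedDual) g.unary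
    unary_unary hex
  -- Only the part of `h` of degree `-1` is kept. It is still a contraction, because the unary
  -- bracket is homogeneous of degree one.
  let comp : (i : ℕ × ZMod 2) →
      (Module.Dual ℝ (g.space.carrier i.1 i.2) →ₗ[ℝ] g.space.ShiftedDual)
    | (0, _) => 0
    | (k + 1, s) => g.space.inDual (k, s) ∘ₗ DirectSum.component ℝ _ _ (k, s) ∘ₗ h ∘ₗ
        g.space.inDual (k + 1, s)
  let h' : g.space.ShiftedDual →ₗ[ℝ] g.space.ShiftedDual := DirectSum.toModule ℝ _ _ comp
  have h0 : ∀ s α, h' (g.space.inDual (0, s) α) = 0 := fun s α =>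
    DirectSum.toModule_lof (φ := comp) ℝ (0, s) α
  have h1 : ∀ k s α, h' (g.space.inDual (k + 1, s) α) =
      g.space.inDual (k, s) (h (g.space.inDual (k + 1, s) α) (k, s)) := fun k s α =>
    DirectSum.toModule_lof (φ := comp) ℝ (k + 1, s) α
  refine ⟨h', h0, fun k s α => ⟨_, h1 k s α⟩, fun v => ?_⟩
  refine LinearMap.congr_fun (f := g.unary ∘ₗ h' + h' ∘ₗ g.unary) (g := LinearMap.id)
    (shiftedDual_hom_ext fun i α => ?_) v
  obtain ⟨k, s⟩ := i
  simp only [LinearMap.add_apply, LinearMap.comp_apply, LinearMap.id_apply]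
  have hu : h' (g.unary (g.space.inDual (k, s) α)) =
      g.space.inDual (k, s) (h (g.unary (g.space.inDual (k, s) α)) (k, s)) := by
    obtain ⟨α', hα'⟩ := (unary_inDual g (k, s) α).1
    rw [hα', h1]
  have hc := congrArg (fun w : g.space.ShiftedDual => g.space.inDual (k, s) (w (k, s)))
    (hh (g.space.inDual (k, s) α))
  have hself : (g.space.inDual (k, s) α) (k, s) = α := by
    rw [inDual, DirectSum.lof_eq_of, DirectSum.of_eq_same]
  rw [hself] at hc
  have hadd : ∀ v w : g.space.ShiftedDual, (v + w) (k, s) = v (k, s) + w (k, s) := fun _ _ => rfl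
  simp only [hadd] at hc
  rw [map_add] at hc
  rw [hu]
  conv_rhs => rw [← hc]
  congr 1
  rcases k with - | k
  · rw [h0, map_zero]
    have hz : ∀ w, (g.unary w) (0, s) = 0 := fun w => by
      refine LinearMap.congr_fun (f := DirectSum.component ℝ _ _ (0, s) ∘ₗ g.unary) (g := 0)
        (shiftedDual_hom_ext fun j β => ?_) w
      obtain ⟨β', hβ'⟩ := (unary_inDual g j β).1
      rw [LinearMap.comp_apply, hβ', LinearMap.zero_apply, inDual, DirectSum.component.of,
        dif_neg (by simp)]
    rw [hz, map_zero]
  · rw [h1]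
    exact map_inDual_component g.unary (fun i => (i.1 + 1, i.2))
      (fun i j hij => by simpa [Prod.ext_iff] using hij) (fun i α => (unary_inDual g i α).1) (k, s) _

/-- The Chevalley--Eilenberg algebra of an acyclic algebra has no cohomology in positive degrees. -/
theorem IsAcyclic.exists_eq_d (hg : g.IsAcyclic) {k : ℕ} {s : ZMod 2} {a : g.CE}
    (ha : a ∈ g.space.homog (k + 1, s)) (hd : g.d a = 0) :
    ∃ b ∈ g.space.homog (k, s), g.d b = a := by
  obtain ⟨h, h0, h1, hh⟩ := hg.exists_contraction
  -- The contraction is extended to a derivation. On component `0` its value is zero, which is put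
  -- in degree `0` only to satisfy the parity condition.
  obtain ⟨H, hH, hHg⟩ := exists_isOddDerivation (g.space.gens ∘ₗ h) (by
    rintro ⟨k, s⟩
    rcases k with - | k
    · exact ⟨0, by simp, fun α => by
        rw [LinearMap.comp_apply, h0, map_zero]; exact Submodule.zero_mem _⟩
    · refine ⟨k + 1, ⟨k + 1, by ring⟩, fun α => ?_⟩
      obtain ⟨α', hα'⟩ := h1 k s α
      rw [LinearMap.comp_apply, hα']
      exact g.space.gen_mem_homog (k, s) α')
  have hH0 : ∀ s α, H (g.space.gen (0, s) α) = 0 := fun s α => by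
    rw [gen, hHg, LinearMap.comp_apply, h0, map_zero]
  have hH1 : ∀ k s α, H (g.space.gen (k + 1, s) α) ∈ g.space.homog (k + 1, s) := fun k s α => by
    obtain ⟨α', hα'⟩ := h1 k s α
    rw [gen, hHg, LinearMap.comp_apply, hα']
    exact g.space.gen_mem_homog (k, s) α'
  -- An element of positive degree has length at least one, so the approximation starts at `N = 0`,
  -- and `k + 1` steps exhaust the degree.
  refine g.diff.exists_eq_d hH hH0 hH1 (fun i α => ?_) (k + 1) 0 a (by omega)
    (homog_le_lengthFiltration_one k s ha) hd
  obtain ⟨k, s⟩ := i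
  have e1 : H (g.d (g.space.gen (k, s) α)) -
      g.space.gens (h (g.unary (g.space.inDual (k, s) α))) ∈
        g.space.lengthFiltration 2 (k + 1, s) := by
    have := hH.map_lengthFiltration_of_lowers hH0 hH1 (unary_inDual g (k, s) α).2
    rwa [map_sub, hHg] at this
  have e2 : g.d (H (g.space.gen (k, s) α)) -
      g.space.gens (g.unary (h (g.space.inDual (k, s) α))) ∈
        g.space.lengthFiltration 2 (k + 1, s) := by
    rw [gen, hHg, LinearMap.comp_apply]
    rcases k with - | k
    · rw [h0]
      simp
    · obtain ⟨α', hα'⟩ := h1 k s α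
      rw [hα']
      exact (unary_inDual g (k, s) α').2
  have e3 : g.space.gen (k, s) α = g.space.gens (g.unary (h (g.space.inDual (k, s) α))) +
      g.space.gens (h (g.unary (g.space.inDual (k, s) α))) := by
    rw [← map_add, hh]
    rfl
  have e := Submodule.add_mem _ e2 e1
  rwa [sub_add_sub_comm, ← e3] at e

end SuperLInfAlgebra
namespace SuperLInfAlgebra

variable {g h k e : SuperLInfAlgebra} {n : ℕ}

/-! ### The linearization -/

/-- The unary bracket squares to zero by itself, so it extends to a differential with no nonlinear
terms. -/
theorem exists_linearizationDiff (e : SuperLInfAlgebra) :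
    ∃ D : e.space.Differential, ∀ v, D.d (e.space.gens v) = e.space.gens (e.unary v) :=
  exists_differential (e.space.gens ∘ₗ e.unary)
    (fun i α => by
      obtain ⟨α', hα'⟩ := (unary_inDual e i α).1
      rw [LinearMap.comp_apply, hα']
      exact e.space.gen_mem_homog (i.1 + 1, i.2) α')
    (fun δ _ hδ i α => by
      rw [LinearMap.comp_apply, hδ, LinearMap.comp_apply, unary_unary, map_zero])

/-- The differential given by the unary bracket only. -/
def linearizationDiff (e : SuperLInfAlgebra) : e.space.Differential :=
  (exists_linearizationDiff e).choose

theorem linearizationDiff_gens (v : e.space.ShiftedDual) :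
    (linearizationDiff e).d (e.space.gens v) = e.space.gens (e.unary v) :=
  (exists_linearizationDiff e).choose_spec v

/-- The abelian `L_∞`-algebra with the same space and unary bracket as `e`. -/
abbrev linearization (e : SuperLInfAlgebra) : SuperLInfAlgebra := ⟨e.space, linearizationDiff e⟩

theorem unary_linearization (v : e.space.ShiftedDual) : (linearization e).unary v = e.unary v := by
  rw [unary_apply]
  refine (congrArg _ (linearizationDiff_gens v)).trans ?_
  exact e.space.linearPart_gens _

theorem IsAcyclic.linearization (he : e.IsAcyclic) : (linearization e).IsAcyclic := fun v hv => by
  obtain ⟨u, hu⟩ := he v ((unary_linearization (e := e) v).symm.trans hv)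
  exact ⟨u, hu.trans (unary_linearization (e := e) u).symm⟩

/-! ### Homomorphisms into the linearization -/

/-- With the contraction `c`, the map `v ↦ gens (c (unary v)) + d (gens (c v))` intertwines the
unary bracket with the full differential, and its linear part is `v`. It is thus a homomorphism from
`e` to its linearization with identity linear component; the second clause is the degree condition
for it. -/
theorem exists_gens_add_d_mem_homog (he : e.IsAcyclic) :
    ∃ c : e.space.ShiftedDual →ₗ[ℝ] e.space.ShiftedDual,
      (∀ v, e.unary (c v) + c (e.unary v) = v) ∧
      ∀ i α, e.space.gens (c (e.unary (e.space.inDual i α))) +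
        e.d (e.space.gens (c (e.space.inDual i α))) ∈ e.space.homog (shift i) := by
  obtain ⟨c, h0, h1, hc⟩ := he.exists_contraction
  refine ⟨c, hc, fun i α => Submodule.add_mem _ ?_ ?_⟩
  · obtain ⟨α', hα'⟩ := (unary_inDual e i α).1
    obtain ⟨α'', hα''⟩ := h1 i.1 i.2 α'
    rw [hα', hα'']
    exact e.space.gen_mem_homog i α''
  · obtain ⟨k, s⟩ := i
    rcases k with - | k
    · rw [h0, map_zero, map_zero]
      exact Submodule.zero_mem _
    · obtain ⟨α', hα'⟩ := h1 k s α
      rw [hα']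
      exact e.diff.map_homog _ _ _ (e.space.gen_mem_homog (k, s) α')

/-- A homomorphism `P : k ⟶ e` with `e` acyclic, and an element `c` of degree `n`, give a homomorphism
from `k` to the linearization of `e` whose linear component is that of `P`, modified along a linear
form on the generators of degree `n + 1` of `e`. -/
theorem exists_hom_linearization (he : e.IsAcyclic) (P : k ⟶ e) {c : k.CE}
    (hc : c ∈ k.space.homog (n, 0)) (ε : e.space.carrier n 0) :
    ∃ A : k ⟶ linearization e, ∀ v : e.space.ShiftedDual, Hom.linear A v = Hom.linear P v +
      ((v (n, 0)) ε • k.space.linearPart (k.d c) +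
        ((e.unary v) (n, 0)) ε • k.space.linearPart c) := by
  obtain ⟨σ, hσ, hdeg⟩ := exists_gens_add_d_mem_homog he
  let ev : e.space.ShiftedDual →ₗ[ℝ] ℝ :=
    LinearMap.applyₗ ε ∘ₗ DirectSum.component ℝ (ℕ × ZMod 2)
      (fun i => Module.Dual ℝ (e.space.carrier i.1 i.2)) (n, 0)
  have hev : ∀ i α, i ≠ (n, 0) → ev (e.space.inDual i α) = 0 := fun i α hi => by
    simp only [ev, LinearMap.comp_apply, inDual]
    rw [DirectSum.component.of, dif_neg hi, map_zero]
  -- The first summand pulls back the map `e ⟶ linearization e` along `P`. The second is also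
  -- compatible with the differentials, as `ev (unary v) • d c` is both its value at `unary v` and
  -- its differential at `v`; it adds the dependence on `c` to the linear component.
  let F : e.space.ShiftedDual →ₗ[ℝ] k.CE :=
    (Hom.toAlgHom P).toLinearMap ∘ₗ (e.space.gens ∘ₗ σ ∘ₗ e.unary + e.d ∘ₗ e.space.gens ∘ₗ σ) +
      (ev.smulRight (k.d c) + (ev ∘ₗ e.unary).smulRight c)
  have hF : ∀ v, F v = Hom.toAlgHom P (e.space.gens (σ (e.unary v)) +
      e.d (e.space.gens (σ v))) + (ev v • k.d c + ev (e.unary v) • c) := fun v => rfl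
  have hFd : ∀ i α, F (e.space.inDual i α) ∈ k.space.homog (shift i) := by
    intro i α
    rw [hF]
    refine Submodule.add_mem _ (Hom.map_homog P _ _ (hdeg i α)) (Submodule.add_mem _ ?_ ?_)
    · by_cases hi : i = (n, 0)
      · subst hi
        exact Submodule.smul_mem _ _ (k.diff.map_homog _ _ _ hc)
      · rw [hev i α hi, zero_smul]
        exact Submodule.zero_mem _
    · obtain ⟨α', hα'⟩ := (unary_inDual e i α).1
      rw [hα']
      by_cases hi : (i.1 + 1, i.2) = (n, (0 : ZMod 2))
      · refine Submodule.smul_mem _ _ ?_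
        rw [shift, hi]
        exact hc
      · rw [hev _ α' hi, zero_smul]
        exact Submodule.zero_mem _
  have hFu : ∀ v, liftGraded F hFd (e.space.gens (e.unary v)) = k.d (F v) := fun v => by
    rw [liftGraded_gens, hF, hF, unary_unary, map_zero, map_zero, map_zero, zero_smul,
      add_zero, zero_add, map_add k.d, map_add k.d, map_smul, map_smul, k.diff.sq_zero, smul_zero,
      zero_add, ← Hom.map_d, map_add e.d, e.diff.sq_zero, add_zero]
  let A : k ⟶ linearization e := Hom.ofGens (g := k) (h := linearization e) F hFd fun i α =>
    (congrArg (liftGraded F hFd) (linearizationDiff_gens _)).trans (hFu _)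
  refine ⟨A, fun v => ?_⟩
  have hA : Hom.toAlgHom A (e.space.gens v) = F v := liftGraded_gens F hFd v
  have h2 : k.space.linearPart (Hom.toAlgHom P (e.d (e.space.gens (σ v)))) =
      Hom.linear P (e.unary (σ v)) := by
    have key : (k.space.linearPart ∘ₗ (Hom.toAlgHom P).toLinearMap ∘ₗ e.d ∘ₗ e.space.gens) =
        Hom.linear P ∘ₗ e.unary := shiftedDual_hom_ext fun i α =>
      linearPart_map _ (gen_map_mem_homog P) (e.diff.map_homog _ _ _ (e.space.gen_mem_homog i α))
    exact LinearMap.congr_fun key (σ v)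
  rw [linear_apply, hA, hF, map_add, map_add, map_add, map_add, map_smul, map_smul, h2,
    ← linear_apply, ← map_add (Hom.linear P), add_comm (σ _), hσ]
  rfl

/-! ### Trivializing an acyclic fibration over `ℝ[n]` -/

theorem linearPart_toAlgHom (f : g ⟶ h) (hn : 1 ≤ n) {s : ZMod 2} {a : h.CE}
    (ha : a ∈ h.space.homog (n, s)) :
    g.space.linearPart (Hom.toAlgHom f a) = Hom.linear f (h.space.linearPart a) := by
  rw [← Nat.sub_add_cancel hn] at ha
  exact linearPart_map _ (gen_map_mem_homog f) ha

/-- Coordinates `y`, `z` in the basis of the two line generators, used below to solve for the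
coefficients of `b` and `c`. -/
theorem exists_line_sum_coordinates (n m : ℕ) :
    ∃ y z : ((line n).sum (line m)).ShiftedDual →ₗ[ℝ] ℝ,
      (∀ w, w = y w • dualMap (sumFst (line n) (line m)) (lineVec n) +
        z w • dualMap (sumSnd (line n) (line m)) (lineVec m)) ∧
      y (dualMap (sumFst (line n) (line m)) (lineVec n)) = 1 ∧
      z (dualMap (sumFst (line n) (line m)) (lineVec n)) = 0 ∧
      y (dualMap (sumSnd (line n) (line m)) (lineVec m)) = 0 ∧
      z (dualMap (sumSnd (line n) (line m)) (lineVec m)) = 1 := by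
  refine ⟨lineEval n ∘ₗ dualMap (sumInl _ _), lineEval m ∘ₗ dualMap (sumInr _ _),
    fun w => ?_, ?_, ?_, ?_, ?_⟩
  · rw [LinearMap.comp_apply, LinearMap.comp_apply, ← map_smul, ← map_smul,
      ← eq_lineEval_smul_lineVec, ← eq_lineEval_smul_lineVec, dualMap_sum]
  · rw [LinearMap.comp_apply, dualMap_sumInl_sumFst, lineEval_lineVec]
  · rw [LinearMap.comp_apply, dualMap_sumInr_sumFst, map_zero]
  · rw [LinearMap.comp_apply, dualMap_sumInl_sumSnd, map_zero]
  · rw [LinearMap.comp_apply, dualMap_sumInr_sumSnd, lineEval_lineVec]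

theorem exists_ext_line_coordinates {D : ((lineAlgebra n).extSpace n).Differential}
    (hD : (lineAlgebra n).IsExtDifferential n (lineGen n) D) :
    ∃ y z : ((lineAlgebra n).extSpace n).ShiftedDual →ₗ[ℝ] ℝ,
      (∀ w, w = y w • Hom.linear hD.proj (lineVec n) +
        z w • ((lineAlgebra n).extSpace n).linearPart ((lineAlgebra n).extGen n)) ∧
      y (Hom.linear hD.proj (lineVec n)) = 1 ∧ z (Hom.linear hD.proj (lineVec n)) = 0 ∧
      y (((lineAlgebra n).extSpace n).linearPart ((lineAlgebra n).extGen n)) = 0 ∧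
      z (((lineAlgebra n).extSpace n).linearPart ((lineAlgebra n).extGen n)) = 1 := by
  have hb : Hom.linear hD.proj (lineVec n) =
    dualMap (sumFst (line n) (line (n - 1))) (lineVec n) := linear_proj hD _
  have hc : ((lineAlgebra n).extSpace n).linearPart ((lineAlgebra n).extGen n) =
    dualMap (sumSnd (line n) (line (n - 1))) (lineVec (n - 1)) := linearComponent_symMap _ _
  rw [hb, hc]
  exact exists_line_sum_coordinates n (n - 1)

/-- The generator of `ℝ[n]`, pulled back along the linear component of a fibration, takes the value one
somewhere. -/
theorem exists_apply_eq_one {q : e ⟶ lineAlgebra n} (hq : IsFibration q) :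
    ∃ ε : e.space.carrier n 0, (Hom.linear q (lineVec n)) (n, 0) ε = 1 := by
  obtain ⟨α, hα⟩ := (linearComponent_inDual _ (gen_map_mem_homog q) (n, 0)
    (lineCoord n (n, 0))).1
  have hα' : Hom.linear q (lineVec n) = e.space.inDual (n, 0) α := hα
  have h0 : α ≠ 0 := by
    rintro rfl
    rw [map_zero] at hα'
    exact lineVec_ne_zero n (hq (hα'.trans (map_zero _).symm))
  obtain ⟨x, hx⟩ := DFunLike.ne_iff.1 h0
  refine ⟨(α x)⁻¹ • x, ?_⟩
  rw [hα', inDual, DirectSum.lof_eq_of, DirectSum.of_eq_same, map_smul]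
  exact inv_mul_cancel₀ hx

/-- An acyclic fibration `q : e ⟶ ℝ[n]` becomes isomorphic over `ℝ[n]`, after taking products with
acyclic algebras, to the extension of `ℝ[n]` by its generator. -/
theorem exists_isIso_prod (hn : 1 ≤ n) (he : e.IsAcyclic) {q : e ⟶ lineAlgebra n}
    (hq : IsFibration q) {D : ((lineAlgebra n).extSpace n).Differential}
    (hD : (lineAlgebra n).IsExtDifferential n (lineGen n) D) :
    ∃ A : e.prod ⟨(lineAlgebra n).extSpace n, D⟩ ⟶
        prod ⟨(lineAlgebra n).extSpace n, D⟩ (linearization e),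
      IsIso A ∧ A ≫ prodFst _ _ ≫ hD.proj = prodFst _ _ ≫ q := by
  -- The pullback of the generator is closed of degree `n + 1`, hence exact; a primitive is what a
  -- lift of `q` to `e₀` needs.
  obtain ⟨γ, hγ, hγd⟩ := he.exists_eq_d (Hom.map_homog q _ _ (lineGen_mem_homog n))
    ((Hom.map_d q _).symm.trans (map_zero (Hom.toAlgHom q)))
  obtain ⟨ε, hε⟩ := exists_apply_eq_one hq
  obtain ⟨y, z, hyz, hyb, hzb, hyc, hzc⟩ := exists_ext_line_coordinates hD
  let e₀ : SuperLInfAlgebra := ⟨(lineAlgebra n).extSpace n, D⟩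
  have hcmem : (lineAlgebra n).extGen n ∈ e₀.space.homog (n, 0) := extGen_mem_homog _ hn
  let r : e ⟶ e₀ := extLift hn hD q γ hγ hγd
  have hrq : r ≫ hD.proj = q := extLift_proj hn hD q γ hγ hγd
  let β : e.space.ShiftedDual := Hom.linear q (lineVec n)
  let γ₁ : e.space.ShiftedDual := e.space.linearPart γ
  let b : e₀.space.ShiftedDual := Hom.linear hD.proj (lineVec n)
  let c : e₀.space.ShiftedDual := e₀.space.linearPart ((lineAlgebra n).extGen n)
  have hrb : Hom.linear r b = β :=
    (linear_comp r hD.proj (lineVec n)).symm.trans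
      (congrArg (fun f => Hom.linear f (lineVec n)) hrq)
  have hrc : Hom.linear r c = γ₁ := by
    rw [← linearPart_toAlgHom r hn hcmem]
    exact congrArg _ (extLift_extGen hn hD q γ hγ hγd)
  have hβ : e.unary β = 0 := by
    refine (linear_unary q (lineVec n)).symm.trans ?_
    exact (congrArg _ (map_zero (line n).linearPart)).trans (map_zero _)
  have hγβ : e.unary γ₁ = β := by
    have hγ' := hγ
    rw [← Nat.sub_add_cancel hn] at hγ'
    rw [unary_apply, ← e.diff.linearPart_d hγ', hγd]
    rfl
  let ev : e.space.ShiftedDual →ₗ[ℝ] ℝ :=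
    LinearMap.applyₗ ε ∘ₗ DirectSum.component ℝ (ℕ × ZMod 2)
      (fun i => Module.Dual ℝ (e.space.carrier i.1 i.2)) (n, 0)
  have hevβ : ev β = 1 := hε
  -- `γ₁` lies in component `n - 1` and `ev` only sees component `n`.
  have hevγ : ev γ₁ = 0 := by
    have hγ' := hγ
    rw [← Nat.sub_add_cancel hn] at hγ'
    obtain ⟨α, hα⟩ := (exists_linearPart_eq hγ').1
    simp only [ev, LinearMap.comp_apply, γ₁]
    rw [hα, inDual, DirectSum.component.of, dif_neg (by simp; omega), map_zero]
  obtain ⟨A₁, hA₁⟩ := exists_hom_linearization he (prodFst e e₀)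
    (Hom.map_homog (prodSnd e e₀) _ _ hcmem) ε
  let A : e.prod e₀ ⟶ e₀.prod (linearization e) := prodLift (prodFst e e₀ ≫ r) A₁
  have hsnd_c : (e.prod e₀).space.linearPart
      (Hom.toAlgHom (prodSnd e e₀) ((lineAlgebra n).extGen n)) =
      dualMap (sumSnd e.space e₀.space) c := by
    rw [linearPart_toAlgHom _ hn hcmem]
    exact linear_prodSnd c
  have hsnd_b : (e.prod e₀).space.linearPart ((e.prod e₀).d
      (Hom.toAlgHom (prodSnd e e₀) ((lineAlgebra n).extGen n))) =
      dualMap (sumSnd e.space e₀.space) b := by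
    rw [← Hom.map_d, linearPart_toAlgHom _ (Nat.le_add_left 1 n) (e₀.diff.map_homog _ _ _ hcmem)]
    rw [← linear_prodSnd]
    exact congrArg (fun x => Hom.linear (prodSnd e e₀) (e₀.space.linearPart x)) hD.2
  have hA₁' : ∀ v, Hom.linear A₁ v = dualMap (sumFst e.space e₀.space) v +
      dualMap (sumSnd e.space e₀.space) (ev v • b + ev (e.unary v) • c) := fun v => by
    rw [hA₁, hsnd_b, hsnd_c, linear_prodFst, map_add, map_smul, map_smul]
    rfl
  have hAfst : ∀ w, Hom.linear A (dualMap (sumFst e₀.space e.space) w) =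
      dualMap (sumFst e.space e₀.space) (Hom.linear r w) := fun w => by
    refine (congrArg _ (linear_prodFst (g := e₀) (h := linearization e) w).symm).trans ?_
    rw [← linear_comp A (prodFst e₀ (linearization e)), prodLift_fst, linear_comp, linear_prodFst]
  have hAsnd : ∀ v, Hom.linear A (dualMap (sumSnd e₀.space e.space) v) = Hom.linear A₁ v :=
    fun v => by
      refine (congrArg _ (linear_prodSnd (g := e₀) (h := linearization e) v).symm).trans ?_
      rw [← linear_comp A (prodSnd e₀ (linearization e)), prodLift_snd]
  -- In coordinates the linear component of `A` is `(w, v) ↦ (r w + v, ev v • b + ev (unary v) •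
  -- c)`. Without the correction the second entry would be zero and `A` could not be invertible.
  have hAx : ∀ w v, Hom.linear A (dualMap (sumFst e₀.space e.space) w +
      dualMap (sumSnd e₀.space e.space) v) =
      dualMap (sumFst e.space e₀.space) (Hom.linear r w + v) +
      dualMap (sumSnd e.space e₀.space) (ev v • b + ev (e.unary v) • c) := fun w v => by
    rw [map_add (Hom.linear A), hAfst, hAsnd, hA₁',
      map_add (dualMap (sumFst e.space e₀.space)), add_assoc]
  refine ⟨A, isIso_of_linear_bijective A ⟨?_, fun x => ?_⟩, ?_⟩
  · refine (injective_iff_map_eq_zero _).2 fun x hx => ?_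
    rw [← dualMap_sum (V := e₀.space) (W := e.space) x] at hx ⊢
    generalize dualMap (sumInl e₀.space e.space) x = w at hx ⊢
    generalize dualMap (sumInr e₀.space e.space) x = v at hx ⊢
    rw [hAx] at hx
    have h1 := congrArg (dualMap (sumInl e.space e₀.space)) hx
    have h2 := congrArg (dualMap (sumInr e.space e₀.space)) hx
    rw [map_add, dualMap_sumInl_sumFst, dualMap_sumInl_sumSnd, add_zero, map_zero, hyz w,
      map_add, map_smul, map_smul] at h1
    rw [map_add, dualMap_sumInr_sumFst, dualMap_sumInr_sumSnd, zero_add, map_zero] at h2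
    change y w • Hom.linear r b + z w • Hom.linear r c + v = 0 at h1
    rw [hrb, hrc] at h1
    have h3 : ev v = 0 := by
      have := congrArg y h2
      rw [map_add, map_smul, map_smul, hyb, hyc, map_zero] at this
      simpa using this
    have h4 : ev (e.unary v) = 0 := by
      have := congrArg z h2
      rw [map_add, map_smul, map_smul, hzb, hzc, map_zero] at this
      simpa using this
    -- In `y w • β + z w • γ₁ + v = 0`, `ev` isolates the first coefficient; after `unary`, which
    -- sends `β` to `0` and `γ₁` to `β`, it isolates the second.
    have h5 : y w = 0 := by
      have := congrArg ev h1
      rw [map_add, map_add, map_smul, map_smul, hevβ, hevγ, h3, map_zero] at this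
      simpa using this
    have h6 : z w = 0 := by
      have := congrArg (fun x => ev (e.unary x)) h1
      simp only [map_add, map_smul, hβ, hγβ, hevβ, h4, map_zero] at this
      simpa using this
    rw [h5, h6, zero_smul, zero_smul, zero_add, zero_add] at h1
    rw [hyz w, h5, h6, h1, zero_smul, zero_smul, add_zero, map_zero, map_zero, add_zero]
  · let v := dualMap (sumInl e.space e₀.space) x
    let w := dualMap (sumInr e.space e₀.space) x
    -- For the preimage `(η b + ζ c, v - η β - ζ γ₁)` the first entry of the image is `v` for every
    -- `η` and `ζ`. The two coefficients are then determined by requiring `ev` and `ev ∘ unary` of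
    -- the second component to be `y w` and `z w`.
    let η := ev v - y w
    let ζ := ev (e.unary v) - z w
    refine ⟨dualMap (sumFst e₀.space e.space) (η • b + ζ • c) +
      dualMap (sumSnd e₀.space e.space) (v - η • β - ζ • γ₁), ?_⟩
    rw [hAx, map_add (Hom.linear r), map_smul, map_smul, hrb, hrc]
    have h1 : η • β + ζ • γ₁ + (v - η • β - ζ • γ₁) = v := by abel
    have h2 : ev (v - η • β - ζ • γ₁) = y w := by
      rw [map_sub, map_sub, map_smul, map_smul, hevβ, hevγ]
      simp [η]
    have h3 : ev (e.unary (v - η • β - ζ • γ₁)) = z w := by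
      simp only [map_sub, map_smul, hβ, hγβ, hevβ, smul_zero, sub_zero]
      simp [ζ]
    rw [h1, h2, h3, ← hyz w]
    exact dualMap_sum x
  · rw [← Category.assoc, prodLift_fst, Category.assoc, hrq]

/-! ### Homotopy fibers -/

/-- The replacement of the point is the extension of `ℝ[n]` by its generator, whose pullback along
`μ` is the given extension on the nose. -/
theorem isHomotopyFiber_proj (hn : 1 ≤ n) {μ : g.CE} (hμ : g.IsCocycle (n + 1) μ)
    {D : (g.extSpace n).Differential} (hD : g.IsExtDifferential n μ D) :
    IsHomotopyFiber hμ.hom hD.proj := by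
  obtain ⟨D₀, hD₀, -⟩ := existsUnique_isExtDifferential (lineAlgebra n) hn (isCocycle_lineGen n)
  obtain ⟨t, ht⟩ := exists_isPullback_proj hn hD hD₀ hμ.hom hμ.hom_lineGen
  exact ⟨_, _, fromPoint _, hD₀.proj, t, hD.proj,
    (isWeakEquivalence_point_iff _).2 (isAcyclic_ext_line hD₀), isFibration_proj hD₀, ht,
    Relation.EqvGen.refl _⟩

theorem equivalentOver_of_isWeakEquivalence {x y : Over g} (f : x ⟶ y)
    (hf : IsWeakEquivalence f.left) : EquivalentOver x y :=
  Relation.EqvGen.rel _ _ ⟨f, hf⟩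

theorem equivalentOver_proj_of_isHomotopyFiber (hn : 1 ≤ n) {μ : g.CE}
    (hμ : g.IsCocycle (n + 1) μ) {D : (g.extSpace n).Differential}
    (hD : g.IsExtDifferential n μ D) {p : k ⟶ g} (hp : IsHomotopyFiber hμ.hom p) :
    EquivalentOver (Over.mk p) (Over.mk hD.proj) := by
  obtain ⟨e, k', i, q, t, p', hi, hq, hpb, hpp'⟩ := hp
  have he := (isWeakEquivalence_point_iff i).1 hi
  obtain ⟨D₀, hD₀, -⟩ := existsUnique_isExtDifferential (lineAlgebra n) hn (isCocycle_lineGen n)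
  obtain ⟨t₀, ht₀⟩ := exists_isPullback_proj hn hD hD₀ hμ.hom hμ.hom_lineGen
  obtain ⟨A, hA, hAq⟩ := exists_isIso_prod hn he hq hD₀
  -- Both total spaces are pullbacks along `μ`: `k' × e₀` of `e × e₀`, and `g_μ × lin e` of `e₀ ×
  -- lin e`. Transporting the first along `A` makes them pullbacks of the same cospan, hence
  -- isomorphic over `g`.
  have pb₁ := (isPullback_prodFst t ⟨(lineAlgebra n).extSpace n, D₀⟩).paste_vert hpb
  have pb₂ := (isPullback_prodFst t₀ (linearization e)).paste_vert ht₀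
  have pb₃ : IsPullback (prodLift (prodFst _ _ ≫ t) (prodSnd _ _) ≫ A) (prodFst _ _ ≫ p')
      (prodFst _ _ ≫ hD₀.proj) hμ.hom :=
    pb₁.of_iso (Iso.refl _) (asIso A) (Iso.refl _) (Iso.refl _) (by simp) (by simp)
      (by simpa using hAq.symm) (by simp)
  let φ := pb₃.isoIsPullback _ _ pb₂
  have hφ : φ.hom ≫ prodFst _ _ ≫ hD.proj = prodFst _ _ ≫ p' := pb₃.isoIsPullback_hom_snd _ _ pb₂
  let x₁ : Over g := Over.mk (prodFst k' ⟨(lineAlgebra n).extSpace n, D₀⟩ ≫ p')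
  let x₂ : Over g := Over.mk (prodFst ⟨g.extSpace n, D⟩ (linearization e) ≫ hD.proj)
  have h₁ : EquivalentOver x₁ (Over.mk p') :=
    equivalentOver_of_isWeakEquivalence (Over.homMk (prodFst _ _) rfl)
      (isWeakEquivalence_prodFst _ (isAcyclic_ext_line hD₀))
  have h₂ : EquivalentOver x₁ x₂ :=
    equivalentOver_of_isWeakEquivalence (Over.homMk φ.hom hφ) (isWeakEquivalence_of_isIso φ.hom)
  have h₃ : EquivalentOver x₂ (Over.mk hD.proj) :=
    equivalentOver_of_isWeakEquivalence (Over.homMk (prodFst _ _) rfl)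
      (isWeakEquivalence_prodFst _ he.linearization)
  -- The zigzag runs from `k'` back to `k' × e₀`, through the isomorphism to `g_μ × lin e`, and down
  -- to `g_μ`.
  exact hpp'.trans _ _ _ ((h₁.symm _ _).trans _ _ _ (h₂.trans _ _ _ h₃))

end SuperLInfAlgebra
end

theorem proposition3p5 (g : SuperLInfAlgebra) (n : ℕ) (hn : 1 ≤ n) (μ : g.CE)
    (hμ : g.IsCocycle (n + 1) μ) :
    (∃! D : (g.extSpace n).Differential, g.IsExtDifferential n μ D) ∧
    ∀ (D : (g.extSpace n).Differential) (hD : g.IsExtDifferential n μ D),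
      SuperLInfAlgebra.IsHomotopyFiber hμ.hom hD.proj ∧
      ∀ (ghat : SuperLInfAlgebra) (p : ghat ⟶ g), SuperLInfAlgebra.IsHomotopyFiber hμ.hom p →
        SuperLInfAlgebra.EquivalentOver (Over.mk p) (Over.mk hD.proj) :=
  ⟨SuperLInfAlgebra.existsUnique_isExtDifferential g hn hμ, fun _ hD =>
    ⟨SuperLInfAlgebra.isHomotopyFiber_proj hn hμ hD, fun _ _ hp =>
      SuperLInfAlgebra.equivalentOver_proj_of_isHomotopyFiber hn hμ hD hp⟩⟩
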